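/- Conventions. A map $f:Y\to X$ between metric spaces is Lipschitz if there is a finite $L\ge 0$ with $d_X(f(y),f(y'))\le L\,d_Y(y,y')$ for all $y,y'\in Y$; it is then called $L$-Lipschitz, and $\mathrm{Lip}(f)$ is the least such $L$ (with $\mathrm{Lip}(f)=\infty$ if $f$ is not Lipschitz). $X$ is a Lipschitz image (resp. $1$-Lipschitz image) of $Y$ if there is a surjective Lipschitz (resp. $1$-Lipschitz) map $Y\to X$. A metric space $Y$ is injective if for every metric space $A$ and every subspace $B\subseteq A$, every $1$-Lipschitz map $B\to Y$ extends to a $1$-Lipschitz map $A\to Y$. For points $x,y$ of a metric space $Y$ put $[x,y]=\{z\in Y: d(x,y)=d(x,z)+d(z,y)\}$. $Y$ is an $\mathbb R$-tree if for all $x,y\in Y$ the set $[x,y]$ is isometric to the real interval $[0,d(x,y)]$, and for all $x,y,z\in Y$ with $[x,y]\cap[y,z]=\{y\}$ one has $d(x,z)=d(x,y)+d(y,z)$. A Urysohn universal space is a complete separable metric space $U$ such that for every finite metric space $B$ and every (possibly empty) subset $A\subseteq B$, every isometric embedding $A\to U$ extends to an isometric embedding $B\to U$. Such a space exists and is unique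 up to isometry. A topological space is analytic if it is a continuous image of a separable complete metric space. A metric space $X$ is Lipschitz connected if for all $x,y\in X$ there is a Lipschitz map $f:[0,1]\to X$ with $f(0)=x$ and $f(1)=y$; its intrinsic metric is then $d_{IX}(x,y)=\inf\{\mathrm{Lip}(f) : f:[0,1]\to X,\ f(0)=x,\ f(1)=y\}$. Theorem. For a non-empty metric space $X$, the following conditions are equivalent: 1. $X$ is a Lipschitz image of a separable injective metric space; 2. $X$ is a Lipschitz image of a separable complete $\mathbb R$-tree; 3. $X$ is a $1$-Lipschitz image of the Urysohn universal space (equivalently: of some Urysohn universal space; of every Urysohn universal space); 4. $X$ is analytic, Lipschitz connected, and the metric space $(X,d_{IX})$ is separable. -/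

import Mathlib

open scoped NNReal ENNReal

universe u

/-- `X` is a Lipschitz image of `Y`: there is a surjective Lipschitz map `Y → X`. -/
def IsLipschitzImage (X Y : Type u) [MetricSpace X] [MetricSpace Y] : Prop :=
  ∃ (K : ℝ≥0) (f : Y → X), LipschitzWith K f ∧ Function.Surjective f

/-- `X` is a `1`-Lipschitz image of `Y`: there is a surjective `1`-Lipschitz map `Y → X`. -/
def IsOneLipschitzImage (X Y : Type u) [MetricSpace X] [MetricSpace Y] : Prop :=
  ∃ f : Y → X, LipschitzWith 1 f ∧ Function.Surjective f

/-- Injective metric space: every `1`-Lipschitz map into `Y` from a subspace `B` of a metric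
space `A` extends to a `1`-Lipschitz map on `A`. -/
def IsInjectiveMetricSpace (Y : Type u) [MetricSpace Y] : Prop :=
  ∀ (A : Type u) [MetricSpace A] (B : Set A) (f : B → Y), LipschitzWith 1 f →
    ∃ g : A → Y, LipschitzWith 1 g ∧ ∀ b : B, g b = f b

/-- The metric segment `[x, y]`. -/
def metricSegment {Y : Type u} [MetricSpace Y] (x y : Y) : Set Y :=
  {z | dist x y = dist x z + dist z y}

/-- `ℝ`-trees: metric segments `[x, y]` are isometric to real intervals `[0, d(x, y)]`, and
segments `[x, y]`, `[y, z]` that meet only in `y` satisfy `d(x, z) = d(x, y) + d(y, z)`. -/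
def IsRTree (Y : Type u) [MetricSpace Y] : Prop :=
  (∀ x y : Y, Nonempty (metricSegment x y ≃ᵢ Set.Icc (0 : ℝ) (dist x y))) ∧
  ∀ x y z : Y, metricSegment x y ∩ metricSegment y z = {y} →
    dist x z = dist x y + dist y z

/-- Urysohn universal metric spaces: complete separable metric spaces `U` such that every
isometric embedding into `U` of a (possibly empty) subset `A` of a finite metric space `B`
extends to an isometric embedding of `B`. -/
def IsUrysohnSpace (U : Type u) [MetricSpace U] : Prop :=
  CompleteSpace U ∧ TopologicalSpace.SeparableSpace U ∧
  ∀ (B : Type u) [MetricSpace B] [Finite B] (A : Set B) (f : A → U), Isometry f →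
    ∃ g : B → U, Isometry g ∧ ∀ a : A, g a = f a

/-- `f` is a path from `x` to `y` in `X` with Lipschitz constant at most `K`. -/
def IsLipschitzPath {X : Type u} [MetricSpace X] (K : ℝ≥0) (f : unitInterval → X)
    (x y : X) : Prop :=
  LipschitzWith K f ∧ f 0 = x ∧ f 1 = y

/-- Any two points are connected by a Lipschitz path. -/
def IsLipschitzConnected (X : Type u) [MetricSpace X] : Prop :=
  ∀ x y : X, ∃ (K : ℝ≥0) (f : unitInterval → X), IsLipschitzPath K f x y

/-- The intrinsic metric: the infimum of the Lipschitz constants of paths `[0, 1] → X` from `x`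
to `y`. It is written with values in `[0, ∞]`; it is `∞` only when there is no Lipschitz path from
`x` to `y`, hence finite if `X` is Lipschitz connected. -/
noncomputable def intrinsicDist {X : Type u} [MetricSpace X] (x y : X) : ℝ≥0∞ :=
  ⨅ (K : ℝ≥0) (_ : ∃ f : unitInterval → X, IsLipschitzPath K f x y), (K : ℝ≥0∞)

/-- The intrinsic metric is separable: some countable set is dense with respect to it. -/
def IntrinsicMetricSeparable (X : Type u) [MetricSpace X] : Prop :=
  ∃ S : Set X, S.Countable ∧ ∀ x : X, ∀ ε : ℝ≥0∞, 0 < ε → ∃ s ∈ S, intrinsicDist x s < ε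

/-- Analytic space: a continuous image of a separable complete metric space. -/
def IsAnalyticSpace (X : Type u) [TopologicalSpace X] : Prop :=
  ∃ (Z : Type u) (_ : MetricSpace Z), CompleteSpace Z ∧ TopologicalSpace.SeparableSpace Z ∧
    ∃ f : Z → X, Continuous f ∧ Function.Surjective f

/-! Everything passes through the last condition. Separable injective spaces, separable complete
`ℝ`-trees and Urysohn spaces are all complete, separable and geodesic. A Lipschitz map carries
geodesics to Lipschitz paths, so an image of such a space is analytic and Lipschitz connected, and
the image of a countable dense set is dense for the intrinsic metric
(`analytic_lipschitzConnected_of_geodesic`).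

Conversely, let `g : Z → X` witness analyticity and let `D` be the countable set of pairs from an
intrinsically dense subset of `X` and a dense subset of `Z`. A branch is a sequence in `D` whose
`X`-terms are joined by paths of length `2⁻ⁿ⁻¹` and converge to `g z`, where `z` is the limit of the
rapidly Cauchy `Z`-terms. It determines a 1-Lipschitz ray in `X`, parametrised by depth: the limit
sits at depth `0`, the `n`-th term at depth `2⁻ⁿ`, and a base point `o` at all large depths. `X`
need not be complete. The `Z`-terms together with the continuity of `g` make the set of branches
closed (`IsConvergentBranch.of_agree`).

Two rays coincide from the depth at which their sequences agree, or else from the depth at which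
both have reached `o`. This depth is an ultrametric on branches. Gluing half-lines along it gives a
separable complete `ℝ`-tree which is also injective (`BranchTree.isRTree`,
`BranchTree.isInjectiveMetricSpace`), and the rays assemble into a 1-Lipschitz surjection onto `X`
(`exists_tree_of_analytic`).

This single tree yields the first two conditions. For Urysohn spaces, embed the tree isometrically,
retract onto the copy by injectivity, then map to `X`. Passing from all Urysohn spaces to some
Urysohn space requires that one exists (`exists_isUrysohnSpace`). -/

/-! ### Criteria for `ℝ`-trees and for injectivity -/

/-- A geodesic metric space satisfying the four-point condition is an `ℝ`-tree. -/
theorem isRTree_of_four_point {Y : Type u} [MetricSpace Y]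
    (four : ∀ x y z w : Y, dist x y + dist z w ≤
      max (dist x z + dist y w) (dist x w + dist y z))
    (geod : ∀ x y : Y, ∃ γ : ℝ → Y, γ 0 = x ∧ γ (dist x y) = y ∧
      ∀ r ∈ Set.Icc 0 (dist x y), ∀ r' ∈ Set.Icc 0 (dist x y), dist (γ r) (γ r') = |r - r'|) :
    IsRTree Y := by
  constructor
  · intro x y
    obtain ⟨γ, h0, h1, hγ⟩ := geod x y
    have hx : ∀ r ∈ Set.Icc 0 (dist x y), dist x (γ r) = r := by
      intro r hr
      have := hγ 0 ⟨le_rfl, dist_nonneg⟩ r hr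
      rw [h0, zero_sub, abs_neg, abs_of_nonneg hr.1] at this
      exact this
    have hy : ∀ r ∈ Set.Icc 0 (dist x y), dist (γ r) y = dist x y - r := by
      intro r hr
      have := hγ r hr (dist x y) ⟨dist_nonneg, le_rfl⟩
      rw [h1, abs_sub_comm, abs_of_nonneg (sub_nonneg.2 hr.2)] at this
      exact this
    refine ⟨(IsometryEquiv.mk' (fun r : Set.Icc (0 : ℝ) (dist x y) =>
      (⟨γ r, ?_⟩ : metricSegment x y))
      (fun z => ⟨dist x z.1, dist_nonneg, ?_⟩) ?_ ?_).symm⟩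
    · have := hx r r.2
      have := hy r r.2
      simp only [metricSegment, Set.mem_ofPred_eq]
      linarith
    · have h : dist x y = dist x z.1 + dist z.1 y := z.2
      have := dist_nonneg (x := z.1) (y := y)
      linarith
    · rintro ⟨z, hz⟩
      have hz : dist x y = dist x z + dist z y := hz
      have hm : dist x z ∈ Set.Icc 0 (dist x y) :=
        ⟨dist_nonneg, by have := dist_nonneg (x := z) (y := y); linarith⟩
      -- Both sums on the right equal `dist x y`, so a point of the segment is determined by its
      -- distance from `x`.
      have h := four x y (γ (dist x z)) z
      have e1 := hx _ hm
      have e2 := hy _ hm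
      rw [dist_comm y z, dist_comm y (γ _), e1, e2] at h
      have h' : dist (γ (dist x z)) z ≤ 0 := by
        rcases le_max_iff.1 h with h | h <;> linarith
      exact Subtype.ext (dist_le_zero.1 h')
    · refine Isometry.of_dist_eq fun a b => ?_
      rw [Subtype.dist_eq, Subtype.dist_eq, Real.dist_eq]
      exact hγ a a.2 b b.2
  · intro x y z hxyz
    obtain ⟨γ, h0, h1, hγ⟩ := geod y x
    -- The Gromov product of `x` and `z` at `y`. The point at distance `r` from `y` lies on both
    -- segments, hence is `y`, and `r = 0`.
    set r := (dist y x + dist y z - dist x z) / 2 with hr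
    have t1 := dist_triangle x y z
    have t2 := dist_triangle y x z
    have t3 := dist_triangle y z x
    rw [dist_comm x y] at t1
    rw [dist_comm z x] at t3
    have hr0 : 0 ≤ r := by linarith
    have hr1 : r ≤ dist y x := by linarith
    have a1 := hγ 0 ⟨le_rfl, dist_nonneg⟩ r ⟨hr0, hr1⟩
    rw [h0, zero_sub, abs_neg, abs_of_nonneg hr0] at a1
    have a2 := hγ r ⟨hr0, hr1⟩ (dist y x) ⟨dist_nonneg, le_rfl⟩
    rw [h1, abs_sub_comm, abs_of_nonneg (sub_nonneg.2 hr1)] at a2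
    have h := four (γ r) z x y
    rw [dist_comm (γ r) y, dist_comm z y, dist_comm x y, dist_comm z x, a1, a2] at h
    have h' : dist (γ r) z ≤ dist y z - r := by
      rcases le_max_iff.1 h with h | h <;> linarith
    have t4 := dist_triangle y (γ r) z
    have hm : γ r ∈ metricSegment x y ∩ metricSegment y z := by
      constructor
      · simp only [metricSegment, Set.mem_ofPred_eq]
        rw [dist_comm x (γ r), dist_comm (γ r) y, dist_comm x y]; linarith
      · simp only [metricSegment, Set.mem_ofPred_eq]
        linarith
    rw [hxyz, Set.mem_singleton_iff] at hm
    rw [hm, dist_self] at a1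
    rw [dist_comm x y]
    linarith

/-- A metric space with the one-point extension property for families of balls is injective. -/
theorem isInjectiveMetricSpace_of_balls {Y : Type u} [MetricSpace Y]
    (h : ∀ (G : Set (Y × ℝ)), (∀ p ∈ G, ∀ q ∈ G, dist p.1 q.1 ≤ p.2 + q.2) →
      ∃ y, ∀ p ∈ G, dist y p.1 ≤ p.2) :
    IsInjectiveMetricSpace Y := by
  intro A _ B f hf
  -- Zorn's lemma on graphs of partial extensions. The inequality forces single values, and the ball
  -- property supplies a value wherever one is missing.
  let R : Set (Set (A × Y)) := {G | ∀ p ∈ G, ∀ q ∈ G, dist p.2 q.2 ≤ dist p.1 q.1}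
  have h0 : Set.range (fun b : B => ((b : A), f b)) ∈ R := by
    rintro _ ⟨b, rfl⟩ _ ⟨c, rfl⟩
    have := hf.dist_le_mul b c
    simpa [Subtype.dist_eq] using this
  obtain ⟨M, hM, hmax⟩ := zorn_subset_nonempty R (by
    intro c hc hchain _
    refine ⟨⋃₀ c, ?_, fun s hs => Set.subset_sUnion_of_mem hs⟩
    rintro p ⟨s, hs, hp⟩ q ⟨t, ht, hq⟩
    rcases hchain.total hs ht with hst | hst
    · exact hc ht p (hst hp) q hq
    · exact hc hs p hp q (hst hq)) _ h0
  have hdom : ∀ a : A, ∃ y, (a, y) ∈ M := by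
    intro a
    obtain ⟨y, hy⟩ := h ((fun p : A × Y => (p.2, dist a p.1)) '' M) (by
      rintro _ ⟨p, hp, rfl⟩ _ ⟨q, hq, rfl⟩
      have h1 := hmax.1 p hp q hq
      have h2 := dist_triangle_left p.1 q.1 a
      exact h1.trans h2)
    have hy' : ∀ p ∈ M, dist y p.2 ≤ dist a p.1 := fun p hp => hy _ ⟨p, hp, rfl⟩
    refine ⟨y, ?_⟩
    have hins : insert (a, y) M ∈ R := by
      rintro p hp q hq
      rcases Set.mem_insert_iff.1 hp with rfl | hp <;>
        rcases Set.mem_insert_iff.1 hq with rfl | hq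
      · simp
      · exact hy' q hq
      · rw [dist_comm, dist_comm p.1]; exact hy' p hp
      · exact hmax.1 p hp q hq
    exact hmax.2 hins (Set.subset_insert _ _) (Set.mem_insert _ _)
  choose g hg using hdom
  refine ⟨g, LipschitzWith.of_dist_le_mul fun a b => ?_, fun b => ?_⟩
  · simpa using hmax.1 _ (hg a) _ (hg b)
  · have := hmax.1 _ (hg b) _ (hM ⟨b, rfl⟩)
    simpa using this

/-! ### The tree of an ultrametric space -/

/-- A non-archimedean pseudo-distance. -/
structure UltraDist (S : Type u) where
  /-- the distance function -/
  δ : S → S → ℝ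
  self : ∀ x, δ x x = 0
  symm : ∀ x y, δ x y = δ y x
  ultra : ∀ x y z, δ x z ≤ max (δ x y) (δ y z)

/-- Pairs of a branch and a depth, before points at distance `0` are identified. -/
structure PreBranchTree {S : Type u} (Δ : UltraDist S) where
  /-- the branch -/
  branch : S
  /-- the depth on the branch -/
  depth : ℝ≥0

namespace PreBranchTree

variable {S : Type u} {Δ : UltraDist S}

/-- The depth at which the branches through two points have merged. -/
noncomputable def meet (p q : PreBranchTree Δ) : ℝ :=
  max (max (p.2 : ℝ) q.2) (Δ.δ p.1 q.1)

theorem meet_comm (p q : PreBranchTree Δ) : meet p q = meet q p := by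
  rw [meet, meet, max_comm (p.2 : ℝ), Δ.symm]

theorem le_meet_left (p q : PreBranchTree Δ) : (p.2 : ℝ) ≤ meet p q :=
  (le_max_left _ _).trans (le_max_left _ _)

theorem le_meet_right (p q : PreBranchTree Δ) : (q.2 : ℝ) ≤ meet p q :=
  (le_max_right _ _).trans (le_max_left _ _)

theorem dist_le_meet (p q : PreBranchTree Δ) : Δ.δ p.1 q.1 ≤ meet p q :=
  le_max_right _ _

theorem meet_le_iff {p q : PreBranchTree Δ} {c : ℝ} :
    meet p q ≤ c ↔ (p.2 : ℝ) ≤ c ∧ (q.2 : ℝ) ≤ c ∧ Δ.δ p.1 q.1 ≤ c := by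
  simp [meet, and_assoc]

theorem meet_self (p : PreBranchTree Δ) : meet p p = p.2 := by
  simp [meet, Δ.self]

theorem meet_ultra (p q r : PreBranchTree Δ) : meet p r ≤ max (meet p q) (meet q r) := by
  refine meet_le_iff.2 ⟨le_max_of_le_left (le_meet_left _ _),
    le_max_of_le_right (le_meet_right _ _), (Δ.ultra _ q.1 _).trans ?_⟩
  exact max_le_max (dist_le_meet _ _) (dist_le_meet _ _)

/-- The length of the path that climbs from each point to the depth where the two branches merge. -/
noncomputable instance : PseudoMetricSpace (PreBranchTree Δ) where
  dist p q := 2 * meet p q - p.2 - q.2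
  dist_self p := by rw [meet_self]; ring
  dist_comm p q := by rw [meet_comm]; ring
  dist_triangle p q r := by
    have h1 := meet_ultra p q r
    have h2 := le_meet_right p q
    have h3 := le_meet_left q r
    rcases le_max_iff.1 h1 with h | h <;> linarith

theorem dist_def (p q : PreBranchTree Δ) : dist p q = 2 * meet p q - p.2 - q.2 := rfl

/-- The depths cancel, leaving the same inequality for `meet`, which follows from its ultrametric
inequality. -/
theorem four_point (x y z w : PreBranchTree Δ) :
    dist x y + dist z w ≤ max (dist x z + dist y w) (dist x w + dist y z) := by
  have key : meet x y + meet z w ≤ max (meet x z + meet y w) (meet x w + meet y z) := by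
    have a1 := meet_ultra x z y
    have a2 := meet_ultra x w y
    have a3 := meet_ultra z x w
    have a4 := meet_ultra z y w
    rw [meet_comm z y] at a1 a4
    rw [meet_comm w y] at a2
    rw [meet_comm z x] at a3
    simp only [le_max_iff] at *
    rcases a1 with a1 | a1 <;> rcases a2 with a2 | a2 <;> rcases a3 with a3 | a3 <;>
      rcases a4 with a4 | a4 <;>
      first
      | (left; linarith)
      | (right; linarith)
      | (rcases le_total (meet x z) (meet x w) with h | h <;>
         rcases le_total (meet y z) (meet y w) with h' | h' <;>
         first
         | (left; linarith)
         | (right; linarith))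
  simp only [dist_def, le_max_iff] at *
  rcases key with h | h
  · left; linarith
  · right; linarith

theorem dist_same_branch (σ : S) (a b : ℝ≥0) :
    dist (⟨σ, a⟩ : PreBranchTree Δ) (⟨σ, b⟩ : PreBranchTree Δ) = |(a : ℝ) - b| := by
  rw [dist_def]
  simp only [meet, Δ.self]
  rcases le_total (a : ℝ) b with h | h
  · rw [max_eq_right h, max_eq_left (NNReal.coe_nonneg b), abs_of_nonpos (sub_nonpos.2 h)]; ring
  · rw [max_eq_left h, max_eq_left (NNReal.coe_nonneg a), abs_of_nonneg (sub_nonneg.2 h)]; ring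

/-- Climb the branch of `p` to the merging depth, then come down the branch of `q`. -/
theorem exists_geodesic (p q : PreBranchTree Δ) : ∃ γ : ℝ → PreBranchTree Δ,
    dist (γ 0) p = 0 ∧ dist (γ (dist p q)) q = 0 ∧
      ∀ r ∈ Set.Icc 0 (dist p q), ∀ r' ∈ Set.Icc 0 (dist p q),
        dist (γ r) (γ r') = |r - r'| := by
  obtain ⟨σ, s⟩ := p
  obtain ⟨τ, t⟩ := q
  set m := meet (⟨σ, s⟩ : PreBranchTree Δ) (⟨τ, t⟩ : PreBranchTree Δ) with hm
  have hs : (s : ℝ) ≤ m := le_meet_left (⟨σ, s⟩ : PreBranchTree Δ) (⟨τ, t⟩ : PreBranchTree Δ)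
  have ht : (t : ℝ) ≤ m := le_meet_right (⟨σ, s⟩ : PreBranchTree Δ) (⟨τ, t⟩ : PreBranchTree Δ)
  have hδ : Δ.δ σ τ ≤ m := dist_le_meet (⟨σ, s⟩ : PreBranchTree Δ) (⟨τ, t⟩ : PreBranchTree Δ)
  have hm' : m = s ∨ m = t ∨ m = Δ.δ σ τ := by
    rw [hm]; simp only [meet]
    rcases max_choice (max (s : ℝ) t) (Δ.δ σ τ) with h | h
    · rcases max_choice (s : ℝ) t with h' | h' <;> rw [h, h'] <;> simp
    · rw [h]; simp
  have hD : dist (⟨σ, s⟩ : PreBranchTree Δ) (⟨τ, t⟩ : PreBranchTree Δ) = 2 * m - s - t := rfl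
  rw [hD]
  set D := 2 * m - s - t with hDdef
  have hs0 : (0 : ℝ) ≤ s := s.2
  have ht0 : (0 : ℝ) ≤ t := t.2
  let γ : ℝ → PreBranchTree Δ := fun r =>
    if r ≤ m - s then ⟨σ, Real.toNNReal (s + r)⟩ else ⟨τ, Real.toNNReal (t + (D - r))⟩
  have hγ1 : ∀ r, r ≤ m - s → γ r = ⟨σ, Real.toNNReal (s + r)⟩ := fun r h => if_pos h
  have hγ2 : ∀ r, m - s < r → γ r = ⟨τ, Real.toNNReal (t + (D - r))⟩ :=
    fun r h => if_neg (not_le.2 h)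
  have cross : ∀ r ∈ Set.Icc 0 D, ∀ r' ∈ Set.Icc 0 D, r ≤ m - s → m - s < r' →
      dist (γ r) (γ r') = |r - r'| := by
    rintro r ⟨h0, h1⟩ r' ⟨h2, h3⟩ h4 h5
    rw [hγ1 r h4, hγ2 r' h5, dist_def]
    have e1 : ((Real.toNNReal (s + r) : ℝ≥0) : ℝ) = s + r :=
      Real.coe_toNNReal _ (by linarith)
    have e2 : ((Real.toNNReal (t + (D - r')) : ℝ≥0) : ℝ) = t + (D - r') :=
      Real.coe_toNNReal _ (by linarith)
    have : meet (⟨σ, Real.toNNReal (s + r)⟩ : PreBranchTree Δ)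
        (⟨τ, Real.toNNReal (t + (D - r'))⟩ : PreBranchTree Δ) = m := by
      apply le_antisymm
      · refine meet_le_iff.2 ⟨?_, ?_, hδ⟩
        · simp only [e1]; linarith
        · simp only [e2]; linarith
      · rcases hm' with h | h | h
        · have := le_meet_left (⟨σ, Real.toNNReal (s + r)⟩ : PreBranchTree Δ)
            (⟨τ, Real.toNNReal (t + (D - r'))⟩ : PreBranchTree Δ)
          simp only [e1] at this; linarith
        · have := le_meet_right (⟨σ, Real.toNNReal (s + r)⟩ : PreBranchTree Δ)
            (⟨τ, Real.toNNReal (t + (D - r'))⟩ : PreBranchTree Δ)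
          simp only [e2] at this; linarith
        · rw [h]; exact dist_le_meet (⟨σ, Real.toNNReal (s + r)⟩ : PreBranchTree Δ)
            (⟨τ, Real.toNNReal (t + (D - r'))⟩ : PreBranchTree Δ)
    rw [this, abs_of_nonpos (by linarith)]
    simp only [e1, e2]
    linarith
  refine ⟨γ, ?_, ?_, ?_⟩
  · rw [hγ1 0 (by linarith), add_zero, Real.toNNReal_coe, dist_self]
  · by_cases h : D ≤ m - s
    -- The path never leaves the first branch; its end is a different representative at distance `0`
    -- from `q`.
    · have hmt : m = t := by linarith
      have e : s + D = t := by linarith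
      rw [hγ1 D h, e, Real.toNNReal_coe, dist_def]
      have : meet (⟨σ, t⟩ : PreBranchTree Δ) (⟨τ, t⟩ : PreBranchTree Δ) ≤ t :=
        meet_le_iff.2 ⟨le_rfl, le_rfl, hδ.trans hmt.le⟩
      have h2 := le_meet_right (⟨σ, t⟩ : PreBranchTree Δ) (⟨τ, t⟩ : PreBranchTree Δ)
      simp only at *
      linarith
    · rw [hγ2 D (not_le.1 h), sub_self, add_zero, Real.toNNReal_coe, dist_self]
  · intro r hr r' hr'
    by_cases h : r ≤ m - s <;> by_cases h' : r' ≤ m - s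
    · rw [hγ1 r h, hγ1 r' h', dist_same_branch, Real.coe_toNNReal _ (by linarith [hr.1]),
        Real.coe_toNNReal _ (by linarith [hr'.1]), add_sub_add_left_eq_sub]
    · exact cross r hr r' hr' h (not_le.1 h')
    · rw [dist_comm, cross r' hr' r hr h' (not_le.1 h), abs_sub_comm]
    · rw [hγ2 r (not_le.1 h), hγ2 r' (not_le.1 h'), dist_same_branch,
        Real.coe_toNNReal _ (by linarith [hr.2]), Real.coe_toNNReal _ (by linarith [hr'.2]),
        abs_sub_comm]
      congr 1; ring

end PreBranchTree

/-- The tree of an ultrametric space: branches indexed by its points, two branches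
being glued above the depth given by their ultrametric distance. -/
abbrev BranchTree {S : Type u} (Δ : UltraDist S) : Type u := SeparationQuotient (PreBranchTree Δ)

namespace BranchTree

open PreBranchTree Filter Topology

variable {S : Type u} {Δ : UltraDist S}

theorem isRTree (Δ : UltraDist S) : IsRTree (BranchTree Δ) := by
  apply isRTree_of_four_point
  · intro x y z w
    obtain ⟨x, rfl⟩ := SeparationQuotient.surjective_mk x
    obtain ⟨y, rfl⟩ := SeparationQuotient.surjective_mk y
    obtain ⟨z, rfl⟩ := SeparationQuotient.surjective_mk z
    obtain ⟨w, rfl⟩ := SeparationQuotient.surjective_mk w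
    simp only [SeparationQuotient.dist_mk]
    exact four_point _ _ _ _
  · intro x y
    obtain ⟨x, rfl⟩ := SeparationQuotient.surjective_mk x
    obtain ⟨y, rfl⟩ := SeparationQuotient.surjective_mk y
    obtain ⟨γ, h0, h1, h⟩ := exists_geodesic x y
    refine ⟨fun r => SeparationQuotient.mk (γ r), ?_, ?_, ?_⟩
    · rw [← dist_eq_zero, SeparationQuotient.dist_mk, h0]
    · rw [← dist_eq_zero, SeparationQuotient.dist_mk, SeparationQuotient.dist_mk, h1]
    · simpa only [SeparationQuotient.dist_mk] using h

/-- Sequences that are Cauchy up to an error `s` converge up to an error `s`. -/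
def _root_.UltraDist.IsComplete (Δ : UltraDist S) : Prop :=
  ∀ (s : ℝ) (σ : ℕ → S), 0 ≤ s →
    (∀ ε > 0, ∃ N, ∀ k ≥ N, ∀ l ≥ N, Δ.δ (σ k) (σ l) ≤ s + ε) →
    ∃ τ, ∀ ε > 0, ∃ N, ∀ k ≥ N, Δ.δ (σ k) τ ≤ s + ε

/-- Depth is 1-Lipschitz, so along a Cauchy sequence it tends to some `s`. The branches are then
Cauchy only up to `s`, which is why `UltraDist.IsComplete` concerns every `s ≥ 0`. -/
theorem completeSpace (hΔ : Δ.IsComplete) : CompleteSpace (BranchTree Δ) := by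
  have : CompleteSpace (PreBranchTree Δ) := by
    refine UniformSpace.complete_of_cauchySeq_tendsto fun u hu => ?_
    rw [Metric.cauchySeq_iff] at hu
    have hdep : ∀ p q : PreBranchTree Δ, dist p.2 q.2 ≤ dist p q := by
      intro p q
      have h1 := le_meet_left p q
      have h2 := le_meet_right p q
      rw [dist_def, NNReal.dist_eq, abs_le]
      constructor <;> linarith
    have hc : CauchySeq fun n => (u n).2 := by
      rw [Metric.cauchySeq_iff]
      intro ε hε
      obtain ⟨N, hN⟩ := hu ε hε
      exact ⟨N, fun m hm n hn => (hdep _ _).trans_lt (hN m hm n hn)⟩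
    obtain ⟨s, hs⟩ := cauchySeq_tendsto_of_complete hc
    rw [Metric.tendsto_atTop] at hs
    obtain ⟨τ, hτ⟩ := hΔ s (fun n => (u n).1) s.2 (by
      intro ε hε
      obtain ⟨N, hN⟩ := hu (ε / 2) (by linarith)
      obtain ⟨N', hN'⟩ := hs (ε / 2) (by linarith)
      refine ⟨max N N', fun k hk l hl => ?_⟩
      have h1 := hN k (le_of_max_le_left hk) l (le_of_max_le_left hl)
      have h2 := hN' k (le_of_max_le_right hk)
      have h3 := hN' l (le_of_max_le_right hl)
      have h4 := dist_le_meet (u k) (u l)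
      rw [dist_def] at h1
      rw [NNReal.dist_eq, abs_lt] at h2 h3
      linarith [h2.2, h3.2])
    refine ⟨⟨τ, s⟩, Metric.tendsto_atTop.2 fun ε hε => ?_⟩
    obtain ⟨N, hN⟩ := hτ (ε / 4) (by linarith)
    obtain ⟨N', hN'⟩ := hs (ε / 4) (by linarith)
    refine ⟨max N N', fun k hk => ?_⟩
    have h1 := hN k (le_of_max_le_left hk)
    have h2 := hN' k (le_of_max_le_right hk)
    rw [NNReal.dist_eq, abs_lt] at h2
    have h3 : meet (u k) (⟨τ, s⟩ : PreBranchTree Δ) ≤ s + ε / 4 :=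
      meet_le_iff.2 ⟨by linarith [h2.2], by simp only; linarith, h1⟩
    rw [dist_def]
    simp only
    linarith [h2.1]
  infer_instance

theorem separableSpace {C : Set S} (hC : C.Countable)
    (hd : ∀ σ, ∀ ε > 0, ∃ c ∈ C, Δ.δ σ c ≤ ε) :
    TopologicalSpace.SeparableSpace (BranchTree Δ) := by
  obtain ⟨Q, hQ, hQd⟩ := TopologicalSpace.exists_countable_dense ℝ≥0
  refine ⟨SeparationQuotient.mk '' ((fun p : S × ℝ≥0 => (⟨p.1, p.2⟩ : PreBranchTree Δ)) '' C ×ˢ Q),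
    ((hC.prod hQ).image _).image _, ?_⟩
  refine SeparationQuotient.surjective_mk.denseRange.dense_image
    SeparationQuotient.continuous_mk ?_
  rw [Metric.dense_iff]
  rintro ⟨σ, s⟩ ε hε
  -- The depth `q` exceeds `s` by at least `ε / 8`, so a branch within `ε / 8` of `σ` has merged
  -- with it at depth `q`.
  obtain ⟨q, hq, hqs⟩ := Metric.dense_iff.1 hQd (s + Real.toNNReal (ε / 4)) (ε / 8)
    (by linarith)
  rw [Metric.mem_ball, NNReal.dist_eq, NNReal.coe_add, Real.coe_toNNReal _ (by linarith),
    abs_lt] at hq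
  obtain ⟨c, hc, hσc⟩ := hd σ (ε / 8) (by linarith)
  refine ⟨(⟨c, q⟩ : PreBranchTree Δ), ?_, (c, q), Set.mk_mem_prod hc hqs, rfl⟩
  rw [Metric.mem_ball, dist_def]
  have hs0 : (0 : ℝ) ≤ s := s.2
  have h3 : meet (⟨c, q⟩ : PreBranchTree Δ) (⟨σ, s⟩ : PreBranchTree Δ) ≤ q :=
    meet_le_iff.2 ⟨le_rfl, by simp only; linarith [hq.1],
      by simp only; rw [Δ.symm]; linarith [hq.1]⟩
  simp only
  linarith [hq.2]

/-- Climbing from a centre by the radius leads to the top of the ball, at depth `b i`. Since the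
balls satisfy the pairwise condition, a lowest top would lie in all of them. The infimum of the `b
i` may not be attained, so a limit of tops is taken, using completeness. -/
theorem isInjectiveMetricSpace [Nonempty S] (hΔ : Δ.IsComplete) :
    IsInjectiveMetricSpace (BranchTree Δ) := by
  have := completeSpace hΔ
  apply isInjectiveMetricSpace_of_balls
  intro G hG
  rcases G.eq_empty_or_nonempty with rfl | hne
  · exact ⟨SeparationQuotient.mk (⟨Classical.arbitrary S, 0⟩ : PreBranchTree Δ), by simp⟩
  have hrep : ∀ i : G, ∃ p : PreBranchTree Δ, SeparationQuotient.mk p = i.1.1 :=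
    fun i => SeparationQuotient.surjective_mk _
  choose y hy using hrep
  have hr : ∀ i : G, 0 ≤ i.1.2 := by
    intro i
    have := hG i.1 i.2 i.1 i.2
    rw [dist_self] at this; linarith
  have hyd : ∀ i j : G, dist (y i) (y j) ≤ i.1.2 + j.1.2 := by
    intro i j
    rw [← SeparationQuotient.dist_mk, hy, hy]
    exact hG i.1 i.2 j.1 j.2
  have : Nonempty G := hne.to_subtype
  let b : G → ℝ := fun i => (y i).2 + i.1.2
  have hb0 : ∀ i, 0 ≤ b i := fun i => add_nonneg (y i).2.2 (hr i)
  have hbdd : BddBelow (Set.range b) := ⟨0, by rintro _ ⟨i, rfl⟩; exact hb0 i⟩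
  set β := ⨅ i, b i with hβ
  have hβle : ∀ i, β ≤ b i := fun i => ciInf_le hbdd i
  have hex : ∀ n : ℕ, ∃ i, b i < β + 1 / (n + 1) := fun n =>
    exists_lt_of_ciInf_lt (lt_add_of_pos_right _ Nat.one_div_pos_of_nat)
  choose k hk using hex
  let q : G → PreBranchTree Δ := fun i => ⟨(y i).1, Real.toNNReal (b i)⟩
  have hq2 : ∀ i, ((q i).2 : ℝ) = b i := fun i => Real.coe_toNNReal _ (hb0 i)
  -- Two branches have merged by the mean of the two top depths, so tops at nearly equal depths are
  -- close.
  have hmeet : ∀ i j, 2 * Δ.δ (y i).1 (y j).1 ≤ b i + b j := by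
    intro i j
    have h1 := hyd i j
    have h2 := dist_le_meet (y i) (y j)
    rw [dist_def] at h1
    simp only [b]
    linarith
  have hqq : ∀ i j, dist (q i) (q j) ≤ |b i - b j| := by
    intro i j
    have h1 := hmeet i j
    have h2 : meet (q i) (q j) ≤ max (b i) (b j) :=
      meet_le_iff.2 ⟨by rw [hq2]; exact le_max_left _ _, by rw [hq2]; exact le_max_right _ _,
        by
          have := le_max_left (b i) (b j)
          have := le_max_right (b i) (b j)
          simp only [q]; linarith⟩
    rw [dist_def, hq2, hq2]
    rcases le_total (b i) (b j) with h | h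
    · rw [max_eq_right h] at h2
      rw [abs_of_nonpos (sub_nonpos.2 h)]; linarith
    · rw [max_eq_left h] at h2
      rw [abs_of_nonneg (sub_nonneg.2 h)]; linarith
  have hqy : ∀ i j ε, 0 ≤ ε → b j ≤ b i + ε → dist (q j) (y i) ≤ i.1.2 + ε := by
    intro i j ε hε hji
    have h1 := hyd j i
    have h2 := dist_le_meet (y j) (y i)
    have h3 := le_meet_right (y j) (y i)
    rw [dist_def] at h1
    rw [dist_def, hq2]
    have hbi : b i = (y i).2 + i.1.2 := rfl
    have hbj : b j = (y j).2 + j.1.2 := rfl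
    have h4 : 2 * meet (q j) (y i) ≤ i.1.2 + ε + b j + (y i).2 := by
      have : meet (q j) (y i) ≤ (i.1.2 + ε + b j + (y i).2) / 2 := by
        refine meet_le_iff.2 ⟨?_, ?_, ?_⟩
        · rw [hq2]; linarith
        · linarith
        · simp only [q]; linarith
      linarith
    linarith
  have hcau : CauchySeq fun n => (SeparationQuotient.mk (q (k n)) : BranchTree Δ) := by
    refine cauchySeq_of_le_tendsto_0 (fun n : ℕ => 1 / ((n : ℝ) + 1)) ?_
      tendsto_one_div_add_atTop_nhds_zero_nat
    intro n m N hn hm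
    rw [SeparationQuotient.dist_mk]
    refine (hqq _ _).trans ?_
    have h1 := hk n
    have h2 := hk m
    have h3 := hβle (k n)
    have h4 := hβle (k m)
    have h5 : 1 / ((n : ℝ) + 1) ≤ 1 / ((N : ℝ) + 1) := Nat.one_div_le_one_div hn
    have h6 : 1 / ((m : ℝ) + 1) ≤ 1 / ((N : ℝ) + 1) := Nat.one_div_le_one_div hm
    rw [abs_le]; constructor <;> linarith
  obtain ⟨z, hz⟩ := cauchySeq_tendsto_of_complete hcau
  refine ⟨z, fun p hp => ?_⟩
  have h1 := hz.dist (tendsto_const_nhds (x := p.1))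
  have h2 : Tendsto (fun n : ℕ => p.2 + 1 / ((n : ℝ) + 1)) atTop (𝓝 (p.2 + 0)) :=
    tendsto_const_nhds.add tendsto_one_div_add_atTop_nhds_zero_nat
  rw [add_zero] at h2
  refine le_of_tendsto_of_tendsto' h1 h2 fun n => ?_
  rw [← hy ⟨p, hp⟩, SeparationQuotient.dist_mk]
  exact hqy ⟨p, hp⟩ (k n) _ Nat.one_div_pos_of_nat.le
    ((hk n).le.trans (by linarith [hβle ⟨p, hp⟩]))

end BranchTree

/-! ### Existence of a Urysohn space -/

/-- Pseudo-distances given by their axioms. -/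
structure IsPseudoDist {ι : Type*} (d : ι → ι → ℝ) : Prop where
  self : ∀ i, d i i = 0
  symm : ∀ i j, d i j = d j i
  triangle : ∀ i j k, d i k ≤ d i j + d j k

theorem IsPseudoDist.nonneg {ι : Type*} {d : ι → ι → ℝ} (h : IsPseudoDist d) (i j : ι) :
    0 ≤ d i j := by
  have := h.triangle i j i
  rw [h.self, h.symm j i] at this
  linarith

/-- Katětov functions: the possible distances to a new point. -/
structure IsKatetov {ι : Type*} (d : ι → ι → ℝ) (k : ι → ℝ) : Prop where
  lip : ∀ i j, k i ≤ k j + d i j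
  le_add : ∀ i j, d i j ≤ k i + k j

theorem IsKatetov.nonneg {ι : Type*} {d : ι → ι → ℝ} (hd : IsPseudoDist d) {k : ι → ℝ}
    (h : IsKatetov d k) (i : ι) : 0 ≤ k i := by
  have := h.le_add i i
  rw [hd.self] at this
  linarith

/-- The pseudo-distance in which the point `n` is moved to distance `k j` from each `j ≠ n`. -/
noncomputable def movePoint (d : ℕ → ℕ → ℝ) (n : ℕ) (k : ℕ → ℝ) (i j : ℕ) : ℝ :=
  if i = n then if j = n then 0 else k j else if j = n then k i else d i j

theorem IsPseudoDist.movePoint {d : ℕ → ℕ → ℝ} (hd : IsPseudoDist d) (n : ℕ) {k : ℕ → ℝ}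
    (hk : IsKatetov d k) : IsPseudoDist (movePoint d n k) := by
  constructor
  · intro i
    unfold _root_.movePoint
    split_ifs <;> simp [hd.self]
  · intro i j
    unfold _root_.movePoint
    split_ifs <;> simp [hd.symm i j]
  · intro i j l
    have h0 := hk.nonneg hd
    have h1 := hk.lip l j
    have h2 := hk.lip i j
    have h3 := hk.le_add i l
    have h4 := hd.triangle i j l
    have h5 := h0 j
    rw [hd.symm l j] at h1
    unfold _root_.movePoint
    split_ifs <;> linarith

/-- A finite list of approximate distances to a new point is consistent. -/
def IsConsistent {ι : Type*} (d : ι → ι → ℝ) (L : Finset (ι × ℚ)) : Prop :=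
  L.Nonempty ∧ ∀ p ∈ L, ∀ q ∈ L, d p.1 q.1 ≤ p.2 + q.2

open Classical in
/-- The Katětov function generated by a consistent list, and the distance to `0` otherwise. -/
noncomputable def listKatetov (d : ℕ → ℕ → ℝ) (L : Finset (ℕ × ℚ)) (j : ℕ) : ℝ :=
  if h : IsConsistent d L then L.inf' h.1 (fun p => (p.2 : ℝ) + d p.1 j) else d 0 j

theorem listKatetov_le {d : ℕ → ℕ → ℝ} {L : Finset (ℕ × ℚ)} (h : IsConsistent d L)
    {p : ℕ × ℚ} (hp : p ∈ L) (j : ℕ) : listKatetov d L j ≤ p.2 + d p.1 j := by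
  rw [listKatetov, dif_pos h]
  exact Finset.inf'_le _ hp

theorem exists_listKatetov_eq {d : ℕ → ℕ → ℝ} {L : Finset (ℕ × ℚ)} (h : IsConsistent d L)
    (j : ℕ) : ∃ p ∈ L, listKatetov d L j = p.2 + d p.1 j := by
  rw [listKatetov, dif_pos h]
  exact Finset.exists_mem_eq_inf' _ _

theorem isKatetov_listKatetov {d : ℕ → ℕ → ℝ} (hd : IsPseudoDist d) (L : Finset (ℕ × ℚ)) :
    IsKatetov d (listKatetov d L) := by
  by_cases h : IsConsistent d L
  · constructor
    · intro i j
      obtain ⟨p, hp, e⟩ := exists_listKatetov_eq h j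
      have h1 := listKatetov_le h hp i
      have h2 := hd.triangle p.1 j i
      rw [hd.symm j i] at h2
      linarith
    · intro i j
      obtain ⟨p, hp, e⟩ := exists_listKatetov_eq h i
      obtain ⟨q, hq, e'⟩ := exists_listKatetov_eq h j
      have h1 := h.2 p hp q hq
      have h2 := hd.triangle i p.1 j
      have h3 := hd.triangle p.1 q.1 j
      rw [hd.symm i p.1] at h2
      linarith
  · have e : listKatetov d L = d 0 := by
      funext j
      rw [listKatetov, dif_neg h]
    rw [e]
    constructor
    · intro i j
      have := hd.triangle 0 j i
      rwa [hd.symm j i] at this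
    · intro i j
      have := hd.triangle i 0 j
      rwa [hd.symm i 0] at this

/-- The approximations to the rational Urysohn pseudo-distance for an enumeration of lists. -/
noncomputable def urysohnApprox (task : ℕ → Finset (ℕ × ℚ)) : ℕ → ℕ → ℕ → ℝ
  | 0 => fun _ _ => 0
  | n + 1 => movePoint (urysohnApprox task n) n (listKatetov (urysohnApprox task n) (task n))

theorem isPseudoDist_urysohnApprox (task : ℕ → Finset (ℕ × ℚ)) (n : ℕ) :
    IsPseudoDist (urysohnApprox task n) := by
  induction n with
  | zero => constructor <;> simp [urysohnApprox]
  | succ n ih => exact ih.movePoint n (isKatetov_listKatetov ih _)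

theorem urysohnApprox_stable (task : ℕ → Finset (ℕ × ℚ)) {n m i j : ℕ} (hn : n ≤ m)
    (hi : i < n) (hj : j < n) : urysohnApprox task m i j = urysohnApprox task n i j := by
  induction m, hn using Nat.le_induction with
  | base => rfl
  | succ m hm ih =>
    rw [urysohnApprox, movePoint, if_neg (by omega), if_neg (by omega), ih]

/-- There is a pseudo-distance on `ℕ` realising all consistent finite lists of approximate
distances. -/
theorem exists_approx_urysohn : ∃ d : ℕ → ℕ → ℝ, IsPseudoDist d ∧
    ∀ L : Finset (ℕ × ℚ), IsConsistent d L → ∃ n, ∀ p ∈ L, d n p.1 ≤ p.2 ∧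
      ∃ q ∈ L, d n p.1 = q.2 + d q.1 p.1 := by
  obtain ⟨enum, henum⟩ := exists_surjective_nat (Finset (ℕ × ℚ))
  -- Every list recurs infinitely often, hence also at a stage beyond all the indices it mentions.
  let task : ℕ → Finset (ℕ × ℚ) := fun n => enum n.unpair.1
  -- By this stage both points have been moved, and their distance is final.
  let d : ℕ → ℕ → ℝ := fun i j => urysohnApprox task (max i j + 1) i j
  have hdN : ∀ N i j, i < N → j < N → d i j = urysohnApprox task N i j := by
    intro N i j hi hj
    exact (urysohnApprox_stable task (by omega) (by omega) (by omega)).symm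
  have hd : IsPseudoDist d := by
    constructor
    · intro i
      exact (isPseudoDist_urysohnApprox task _).self i
    · intro i j
      have h := hdN (max i j + 1)
      rw [h i j (by omega) (by omega), h j i (by omega) (by omega)]
      exact (isPseudoDist_urysohnApprox task _).symm i j
    · intro i j k
      have h := hdN (max (max i j) k + 1)
      rw [h i k (by omega) (by omega), h i j (by omega) (by omega), h j k (by omega) (by omega)]
      exact (isPseudoDist_urysohnApprox task _).triangle i j k
  refine ⟨d, hd, fun L hL => ?_⟩
  obtain ⟨c, hc⟩ := henum L
  set M := L.sup Prod.fst + 1 with hM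
  have hlt : ∀ p ∈ L, p.1 < M := fun p hp => Nat.lt_succ_of_le (Finset.le_sup (f := Prod.fst) hp)
  set n := Nat.pair c M with hn
  have hMn : M ≤ n := Nat.right_le_pair c M
  have htask : task n = L := by simp only [task, hn, Nat.unpair_pair, hc]
  have hLn : IsConsistent (urysohnApprox task n) L := by
    refine ⟨hL.1, fun p hp q hq => ?_⟩
    have := hlt p hp
    have := hlt q hq
    rw [← hdN n p.1 q.1 (by omega) (by omega)]
    exact hL.2 p hp q hq
  have hval : ∀ p ∈ L, d n p.1 = listKatetov (urysohnApprox task n) L p.1 := by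
    intro p hp
    have := hlt p hp
    rw [hdN (n + 1) n p.1 (by omega) (by omega), urysohnApprox, movePoint, if_pos rfl,
      if_neg (by omega), htask]
  refine ⟨n, fun p hp => ⟨?_, ?_⟩⟩
  · rw [hval p hp]
    refine (listKatetov_le hLn hp _).trans ?_
    rw [(isPseudoDist_urysohnApprox task n).self, add_zero]
  · obtain ⟨q, hq, e⟩ := exists_listKatetov_eq hLn p.1
    refine ⟨q, hq, ?_⟩
    have := hlt p hp
    have := hlt q hq
    rw [hval p hp, e, hdN n q.1 p.1 (by omega) (by omega)]

/-- Approximate realisation of consistent finite families of distances. -/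
def HasApproxPoints (U : Type u) [MetricSpace U] : Prop :=
  ∀ (ι : Type u) [Finite ι] [Nonempty ι] (v : ι → U) (ρ : ι → ℝ),
    (∀ i j, dist (v i) (v j) ≤ ρ i + ρ j) → ∀ ε > 0,
      ∃ w, ∀ i, dist w (v i) ≤ ρ i + ε ∧ ∃ j, ρ j + dist (v j) (v i) - ε ≤ dist w (v i)

/-- A copy of `ℕ` without a preferred metric. -/
structure NatPoint : Type u where
  /-- the underlying natural number -/
  index : ℕ

instance : Countable NatPoint.{u} :=
  Function.Injective.countable (f := NatPoint.index) fun ⟨_⟩ ⟨_⟩ h => congrArg _ h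

instance : Nonempty NatPoint.{u} := ⟨⟨0⟩⟩

theorem exists_hasApproxPoints : ∃ (U : Type u) (_ : MetricSpace U), CompleteSpace U ∧
    TopologicalSpace.SeparableSpace U ∧ Nonempty U ∧ HasApproxPoints U := by
  obtain ⟨d, hd, hL⟩ := exists_approx_urysohn
  let _ : PseudoMetricSpace (NatPoint.{u}) :=
    { dist := fun i j => d i.index j.index
      dist_self := fun i => hd.self _
      dist_comm := fun i j => hd.symm _ _
      dist_triangle := fun i j k => hd.triangle _ _ _ }
  have hdist : ∀ i j : NatPoint.{u}, dist i j = d i.index j.index := fun _ _ => rfl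
  refine ⟨UniformSpace.Completion (NatPoint.{u}), inferInstance, inferInstance, inferInstance,
    ⟨((⟨0⟩ : NatPoint.{u}) : UniformSpace.Completion NatPoint.{u})⟩, ?_⟩
  intro ι _ _ v ρ hρ ε hε
  have := Fintype.ofFinite ι
  have happ : ∀ i, ∃ a : NatPoint.{u}, dist (v i) (a : UniformSpace.Completion (NatPoint.{u}))
      < ε / 8 := by
    intro i
    exact UniformSpace.Completion.denseRange_coe.exists_dist_lt (v i) (by linarith)
  choose a ha using happ
  -- The excess of at least `ε / 8` per point keeps the list consistent when passing from the `v i`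
  -- to the `a i` changes distances by up to `ε / 4`.
  have hq : ∀ i, ∃ q : ℚ, ρ i + ε / 8 < q ∧ (q : ℝ) < ρ i + ε / 4 :=
    fun i => exists_rat_btwn (by linarith)
  choose q hq1 hq2 using hq
  have had : ∀ i j, |dist (v i) (v j) - d (a i).index (a j).index| ≤ ε / 4 := by
    intro i j
    rw [← hdist (a i) (a j), ← UniformSpace.Completion.dist_eq (a i) (a j)]
    have h1 := dist_dist_dist_le (v i) (v j) (a i : UniformSpace.Completion (NatPoint.{u})) (a j)
    rw [Real.dist_eq] at h1
    linarith [ha i, ha j]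
  let L : Finset (ℕ × ℚ) := Finset.univ.image fun i => ((a i).index, q i)
  have hLc : IsConsistent d L := by
    refine ⟨Finset.univ_nonempty.image _, ?_⟩
    intro p hp p' hp'
    obtain ⟨i, -, rfl⟩ := Finset.mem_image.1 hp
    obtain ⟨j, -, rfl⟩ := Finset.mem_image.1 hp'
    have := (abs_le.1 (had i j)).1
    have := hρ i j
    have := hq1 i
    have := hq1 j
    simp only
    linarith
  obtain ⟨n, hn⟩ := hL L hLc
  refine ⟨((⟨n⟩ : NatPoint.{u}) : UniformSpace.Completion (NatPoint.{u})), fun i => ?_⟩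
  obtain ⟨h1, p, hp, h2⟩ := hn ((a i).index, q i)
    (Finset.mem_image.2 ⟨i, Finset.mem_univ _, rfl⟩)
  obtain ⟨j, -, rfl⟩ := Finset.mem_image.1 hp
  simp only at h1 h2
  have e : dist ((⟨n⟩ : NatPoint.{u}) : UniformSpace.Completion (NatPoint.{u})) (a i) =
    d n (a i).index := UniformSpace.Completion.dist_eq _ _
  have t1 := dist_triangle_right ((⟨n⟩ : NatPoint.{u}) : UniformSpace.Completion (NatPoint.{u}))
    (v i) (a i)
  have t2 := dist_triangle ((⟨n⟩ : NatPoint.{u}) : UniformSpace.Completion (NatPoint.{u}))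
    (v i) (a i)
  have := ha i
  have := hq1 j
  have := hq2 i
  have := (abs_le.1 (had j i)).2
  exact ⟨by linarith, j, by linarith⟩

/-- In a complete space with approximate points, Katětov families are realised exactly. -/
theorem HasApproxPoints.exists_dist_eq {U : Type u} [MetricSpace U] [CompleteSpace U]
    [Nonempty U] (hU : HasApproxPoints U) {ι : Type u} [Finite ι] (v : ι → U) (ρ : ι → ℝ)
    (h1 : ∀ i j, dist (v i) (v j) ≤ ρ i + ρ j) (h2 : ∀ i j, ρ i ≤ ρ j + dist (v i) (v j)) :
    ∃ w, ∀ i, dist w (v i) = ρ i := by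
  classical
  rcases isEmpty_or_nonempty ι with hι | hι
  · exact ⟨Classical.arbitrary U, fun i => (hι.false i).elim⟩
  let P : ℕ → U → Prop := fun n w => ∀ i, |dist w (v i) - ρ i| ≤ (1 / 2) ^ n
  have hstart : ∃ w, P 0 w := by
    obtain ⟨w, hw⟩ := hU ι v ρ h1 1 one_pos
    refine ⟨w, fun i => ?_⟩
    obtain ⟨hw1, j, hw2⟩ := hw i
    have := h2 i j
    rw [dist_comm (v i)] at this
    rw [pow_zero, abs_le]
    constructor <;> linarith
  have hstep : ∀ n w, P n w → ∃ w', P (n + 1) w' ∧ dist w w' ≤ 2 * (1 / 2) ^ n := by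
    intro n w hw
    have hpos : (0 : ℝ) < (1 / 2) ^ n := by positivity
    have hpos' : (0 : ℝ) < (1 / 2) ^ (n + 1) := by positivity
    -- The current approximation joins the family with prescribed distance `2⁻ⁿ`, which keeps the
    -- successive points Cauchy.
    obtain ⟨w', hw'⟩ := hU (Option ι) (fun o => o.elim w v) (fun o => o.elim ((1 / 2) ^ n) ρ) (by
      rintro (_ | i) (_ | j)
      · simp
      · have := (abs_le.1 (hw j)).2
        simp only [Option.elim]; linarith
      · have := (abs_le.1 (hw i)).2
        simp only [Option.elim]; rw [dist_comm]; linarith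
      · exact h1 i j) ((1 / 2) ^ (n + 1)) hpos'
    refine ⟨w', fun i => ?_, ?_⟩
    · obtain ⟨hw1, j, hw2⟩ := hw' (some i)
      simp only [Option.elim] at hw1
      rw [abs_le]
      refine ⟨?_, by linarith⟩
      rcases j with _ | j
      · have := (abs_le.1 (hw i)).1
        simp only [Option.elim] at hw2
        linarith
      · have := h2 i j
        rw [dist_comm (v i)] at this
        simp only [Option.elim] at hw2
        linarith
    · obtain ⟨hw1, -⟩ := hw' none
      simp only [Option.elim] at hw1
      rw [dist_comm]
      refine hw1.trans ?_
      rw [pow_succ]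
      linarith
  let seq : ∀ n : ℕ, {w // P n w} := fun n => Nat.rec ⟨hstart.choose, hstart.choose_spec⟩
    (fun n w => ⟨(hstep n w.1 w.2).choose, (hstep n w.1 w.2).choose_spec.1⟩) n
  have hseq : ∀ n, dist (seq n).1 (seq (n + 1)).1 ≤ 2 * (1 / 2) ^ n :=
    fun n => (hstep n (seq n).1 (seq n).2).choose_spec.2
  obtain ⟨w, hw⟩ := cauchySeq_tendsto_of_complete
    (cauchySeq_of_le_geometric (1 / 2) 2 (by norm_num) hseq)
  refine ⟨w, fun i => ?_⟩
  have t1 : Filter.Tendsto (fun n => |dist (seq n).1 (v i) - ρ i|) Filter.atTop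
      (nhds |dist w (v i) - ρ i|) :=
    ((hw.dist tendsto_const_nhds).sub tendsto_const_nhds).abs
  have t2 : Filter.Tendsto (fun n : ℕ => ((1 : ℝ) / 2) ^ n) Filter.atTop (nhds 0) :=
    tendsto_pow_atTop_nhds_zero_of_lt_one (by norm_num) (by norm_num)
  have := le_of_tendsto_of_tendsto' t1 t2 fun n => (seq n).2 i
  exact sub_eq_zero.1 (abs_nonpos_iff.1 this)

/-- The points of `B` are added one at a time; the distances to the new point form a Katětov family,
which is realised exactly. -/
theorem exists_isUrysohnSpace : ∃ (U : Type u) (_ : MetricSpace U), IsUrysohnSpace U := by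
  obtain ⟨U, _, hc, hs, hne, hU⟩ := exists_hasApproxPoints.{u}
  refine ⟨U, inferInstance, hc, hs, ?_⟩
  intro B _ _ A f hf
  classical
  have key : ∀ S : Set B, S.Finite → ∃ g : B → U,
      (∀ x ∈ A ∪ S, ∀ y ∈ A ∪ S, dist (g x) (g y) = dist x y) ∧ ∀ a : A, g a = f a := by
    intro S hS
    induction S, hS using Set.Finite.induction_on with
    | empty =>
      refine ⟨fun b => if h : b ∈ A then f ⟨b, h⟩ else Classical.arbitrary U, ?_, ?_⟩
      · intro x hx y hy
        rw [Set.union_empty] at hx hy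
        simp only [dif_pos hx, dif_pos hy]
        exact hf.dist_eq ⟨x, hx⟩ ⟨y, hy⟩
      · intro a
        simp only [dif_pos a.2]
    | @insert b S hb hS ih =>
      obtain ⟨g, hg, hgA⟩ := ih
      by_cases hbA : b ∈ A
      · refine ⟨g, ?_, hgA⟩
        have : A ∪ insert b S = A ∪ S := by
          rw [Set.union_insert, Set.insert_eq_of_mem (Set.mem_union_left _ hbA)]
        rwa [this]
      obtain ⟨w, hw⟩ := hU.exists_dist_eq (ι := ↥(A ∪ S)) (fun x => g x) (fun x => dist b x.1)
        (fun x y => by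
          rw [hg x x.2 y y.2]; exact dist_triangle_left _ _ _)
        (fun x y => by
          rw [hg x x.2 y y.2, dist_comm x.1]; exact dist_triangle _ _ _)
      have hne : ∀ x ∈ A ∪ S, x ≠ b := by
        rintro x (hx | hx) rfl
        · exact hbA hx
        · exact hb hx
      refine ⟨Function.update g b w, ?_, fun a => ?_⟩
      · rw [Set.union_insert]
        intro x hx y hy
        rcases Set.mem_insert_iff.1 hx with hxb | hx <;>
          rcases Set.mem_insert_iff.1 hy with hyb | hy
        · simp [hxb, hyb]
        · rw [hxb, Function.update_self, Function.update_of_ne (hne y hy)]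
          exact hw ⟨y, hy⟩
        · rw [hyb, Function.update_self, Function.update_of_ne (hne x hx), dist_comm, dist_comm x]
          exact hw ⟨x, hx⟩
        · rw [Function.update_of_ne (hne x hx), Function.update_of_ne (hne y hy)]
          exact hg x hx y hy
      · rw [Function.update_of_ne (hne a (Or.inl a.2)), hgA]
  obtain ⟨g, hg, hgA⟩ := key Set.univ Set.finite_univ
  exact ⟨g, Isometry.of_dist_eq fun x y => hg x (by simp) y (by simp), hgA⟩

/-! ### Paths of bounded length -/

/-- `x` and `y` are the ends of a path of length at most `r`. -/
def JoinedBy {X : Type u} [MetricSpace X] (x y : X) (r : ℝ) : Prop :=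
  ∃ φ : ℝ → X, LipschitzWith 1 φ ∧ (∀ t ≤ 0, φ t = x) ∧ ∀ t ≥ r, φ t = y

namespace JoinedBy

variable {X : Type u} [MetricSpace X] {x y z : X} {r s : ℝ}

theorem mono (h : JoinedBy x y r) (hrs : r ≤ s) : JoinedBy x y s := by
  obtain ⟨φ, h1, h2, h3⟩ := h
  exact ⟨φ, h1, h2, fun t ht => h3 t (hrs.trans ht)⟩

theorem dist_le (h : JoinedBy x y r) (hr : 0 ≤ r) : dist x y ≤ r := by
  obtain ⟨φ, h1, h2, h3⟩ := h
  have := h1.dist_le_mul 0 r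
  rw [h2 0 le_rfl, h3 r le_rfl, Real.dist_eq, zero_sub, abs_neg, abs_of_nonneg hr] at this
  simpa using this

theorem symm (h : JoinedBy x y r) : JoinedBy y x r := by
  obtain ⟨φ, h1, h2, h3⟩ := h
  refine ⟨fun t => φ (r - t), LipschitzWith.of_dist_le_mul fun a b => ?_,
    fun t ht => h3 _ (by linarith), fun t ht => h2 _ (by linarith)⟩
  have := h1.dist_le_mul (r - a) (r - b)
  rwa [dist_sub_left] at this

/-- Gluing two `1`-Lipschitz functions on the line. -/
theorem _root_.LipschitzWith.glue {φ ψ : ℝ → X} (hφ : LipschitzWith 1 φ)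
    (hψ : LipschitzWith 1 ψ) {c : ℝ} (hc : φ c = ψ c) :
    LipschitzWith 1 fun t => if t ≤ c then φ t else ψ t := by
  have cross : ∀ a b, a ≤ c → c ≤ b → dist (φ a) (ψ b) ≤ |a - b| := by
    intro a b ha hb
    have h1 := hφ.dist_le_mul a c
    have h2 := hψ.dist_le_mul c b
    have h3 := dist_triangle (φ a) (φ c) (ψ b)
    rw [hc] at h1 h3
    rw [NNReal.coe_one, one_mul, Real.dist_eq, abs_of_nonpos (by linarith)] at h1 h2
    rw [abs_of_nonpos (by linarith)]
    linarith
  refine LipschitzWith.of_dist_le_mul fun a b => ?_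
  rw [NNReal.coe_one, one_mul, Real.dist_eq]
  split_ifs with h1 h2 h2
  · simpa [Real.dist_eq] using hφ.dist_le_mul a b
  · exact cross a b h1 (not_le.1 h2).le
  · rw [dist_comm, abs_sub_comm]; exact cross b a h2 (not_le.1 h1).le
  · simpa [Real.dist_eq] using hψ.dist_le_mul a b

theorem trans (h : JoinedBy x y r) (h' : JoinedBy y z s) (hr : 0 ≤ r) (hs : 0 ≤ s) :
    JoinedBy x z (r + s) := by
  obtain ⟨φ, h1, h2, h3⟩ := h
  obtain ⟨ψ, k1, k2, k3⟩ := h'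
  have hψ : LipschitzWith 1 fun t => ψ (t - r) := LipschitzWith.of_dist_le_mul fun a b => by
    have := k1.dist_le_mul (a - r) (b - r)
    rwa [dist_sub_right] at this
  refine ⟨_, h1.glue hψ (c := r) ?_, fun t ht => ?_, fun t ht => ?_⟩
  · rw [h3 r le_rfl, k2 _ (by linarith)]
  · rw [if_pos (by linarith)]; exact h2 t ht
  · split_ifs with h
    -- Here `t ≤ r` and `r + s ≤ t` force `s = 0`, so the second path is trivial and `y = z`.
    · rw [h3 t (by linarith), ← k2 0 le_rfl, k3 0 (by linarith)]
    · exact k3 _ (by linarith)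

theorem of_line {φ : ℝ → X} (hφ : LipschitzWith 1 φ) {a b : ℝ} (hab : |a - b| ≤ r) :
    JoinedBy (φ a) (φ b) r := by
  have key : ∀ a b : ℝ, a ≤ b → JoinedBy (φ a) (φ b) (b - a) := by
    intro a b h
    refine ⟨fun t => φ (Set.projIcc a b h (a + t)), LipschitzWith.of_dist_le_mul fun s t => ?_,
      fun t ht => ?_, fun t ht => ?_⟩
    · refine (hφ.dist_le_mul _ _).trans ?_
      have := (LipschitzWith.projIcc h).dist_le_mul (a + s) (a + t)
      rw [dist_add_left, Subtype.dist_eq] at this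
      rw [NNReal.coe_one, one_mul]
      exact this
    · change φ (Set.projIcc a b h (a + t)) = φ a
      rw [Set.projIcc_of_le_left h (by linarith)]
    · change φ (Set.projIcc a b h (a + t)) = φ b
      rw [Set.projIcc_of_right_le h (by linarith)]
  rcases le_total a b with h | h
  · rw [abs_of_nonpos (by linarith)] at hab
    exact (key a b h).mono (by linarith)
  · rw [abs_of_nonneg (by linarith)] at hab
    exact (key b a h).symm.mono (by linarith)

theorem map {Y : Type u} [MetricSpace Y] {f : X → Y} {K : ℝ≥0} (hf : LipschitzWith K f)
    (hK : 0 < K) (h : JoinedBy x y r) : JoinedBy (f x) (f y) (K * r) := by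
  obtain ⟨φ, h1, h2, h3⟩ := h
  have hK' : (0 : ℝ) < K := hK
  refine ⟨fun t => f (φ (t / K)), LipschitzWith.of_dist_le_mul fun a b => ?_,
    fun t ht => ?_, fun t ht => ?_⟩
  · refine (hf.dist_le_mul _ _).trans ?_
    have := h1.dist_le_mul (a / K) (b / K)
    rw [Real.dist_eq, ← sub_div, abs_div, abs_of_pos hK', NNReal.coe_one, one_mul] at this
    rw [NNReal.coe_one, one_mul, Real.dist_eq]
    calc K * dist (φ (a / K)) (φ (b / K)) ≤ K * (|a - b| / K) := by gcongr
      _ = |a - b| := by field_simp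
  · exact congrArg f (h2 _ (div_nonpos_of_nonpos_of_nonneg ht hK'.le))
  · exact congrArg f (h3 _ ((le_div_iff₀ hK').2 (by rw [mul_comm]; exact ht)))

theorem exists_isLipschitzPath (h : JoinedBy x y r) (hr : 0 ≤ r) :
    ∃ f, IsLipschitzPath r.toNNReal f x y := by
  obtain ⟨φ, h1, h2, h3⟩ := h
  refine ⟨fun t => φ (r * t), LipschitzWith.of_dist_le_mul fun a b => ?_, ?_, ?_⟩
  · refine (h1.dist_le_mul _ _).trans ?_
    rw [NNReal.coe_one, one_mul, Real.coe_toNNReal r hr, Subtype.dist_eq, Real.dist_eq,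
      Real.dist_eq, ← mul_sub, abs_mul, abs_of_nonneg hr]
  · exact h2 _ (by simp)
  · exact h3 _ (by simp)

theorem intrinsicDist_le (h : JoinedBy x y r) (hr : 0 ≤ r) :
    intrinsicDist x y ≤ ENNReal.ofReal r :=
  iInf₂_le r.toNNReal (h.exists_isLipschitzPath hr)

end JoinedBy

theorem IsLipschitzPath.joinedBy {X : Type u} [MetricSpace X] {x y : X} {K : ℝ≥0}
    {f : unitInterval → X} (h : IsLipschitzPath K f x y) {r : ℝ} (hK : K ≤ r) (hr : 0 < r) :
    JoinedBy x y r := by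
  obtain ⟨h1, h2, h3⟩ := h
  refine ⟨fun t => f (Set.projIcc 0 1 zero_le_one (t / r)),
    LipschitzWith.of_dist_le_mul fun a b => ?_, fun t ht => ?_, fun t ht => ?_⟩
  · refine (h1.dist_le_mul _ _).trans ?_
    have := (LipschitzWith.projIcc (zero_le_one (α := ℝ))).dist_le_mul (a / r) (b / r)
    rw [Real.dist_eq (a / r), ← sub_div, abs_div, abs_of_pos hr, NNReal.coe_one, one_mul] at this
    rw [NNReal.coe_one, one_mul, Real.dist_eq]
    refine (mul_le_mul hK this dist_nonneg hr.le).trans (le_of_eq ?_)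
    field_simp
  · exact (congrArg f (Set.projIcc_of_le_left _
      (div_nonpos_of_nonpos_of_nonneg ht hr.le))).trans h2
  · exact (congrArg f (Set.projIcc_of_right_le _
      ((le_div_iff₀ hr).2 (by rw [one_mul]; exact ht)))).trans h3

theorem joinedBy_of_intrinsicDist_lt {X : Type u} [MetricSpace X] {x y : X} {r : ℝ}
    (h : intrinsicDist x y < ENNReal.ofReal r) : JoinedBy x y r := by
  have hr : 0 < r := ENNReal.ofReal_pos.1 (bot_le.trans_lt h)
  simp only [intrinsicDist, iInf_lt_iff] at h
  obtain ⟨K, ⟨f, hf⟩, hK⟩ := h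
  refine hf.joinedBy ?_ hr
  rw [ENNReal.ofReal, ENNReal.coe_lt_coe] at hK
  exact (NNReal.coe_lt_coe.2 hK).le.trans (Real.coe_toNNReal r hr.le).le

/-! ### Geodesic spaces and their Lipschitz images -/

/-- Lipschitz images of separable complete geodesic spaces. -/
theorem analytic_lipschitzConnected_of_geodesic {X Y : Type u} [MetricSpace X] [MetricSpace Y]
    [CompleteSpace Y] [TopologicalSpace.SeparableSpace Y]
    (hY : ∀ x y : Y, JoinedBy x y (dist x y)) (h : IsLipschitzImage X Y) :
    IsAnalyticSpace X ∧ IsLipschitzConnected X ∧ IntrinsicMetricSeparable X := by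
  obtain ⟨K, f, hf, hsurj⟩ := h
  -- `K` may be `0`, while reparametrising the image of a path divides by the constant.
  have hf' : LipschitzWith (K + 1) f := hf.weaken (by simp)
  have hK : 0 < K + 1 := by positivity
  have hX : ∀ x y : Y, JoinedBy (f x) (f y) ((K + 1 : ℝ≥0) * dist x y) :=
    fun x y => (hY x y).map hf' hK
  refine ⟨⟨Y, inferInstance, inferInstance, inferInstance, f, hf.continuous, hsurj⟩, ?_, ?_⟩
  · intro x y
    obtain ⟨x, rfl⟩ := hsurj x
    obtain ⟨y, rfl⟩ := hsurj y
    exact ⟨_, (hX x y).exists_isLipschitzPath (by positivity)⟩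
  · obtain ⟨S, hS, hSd⟩ := TopologicalSpace.exists_countable_dense Y
    refine ⟨f '' S, hS.image f, fun x ε hε => ?_⟩
    obtain ⟨x, rfl⟩ := hsurj x
    obtain ⟨δ, hδ, hδε⟩ := ENNReal.lt_iff_exists_nnreal_btwn.1 hε
    have hδ0 : (0 : ℝ) < δ := by exact_mod_cast hδ
    have hK' : (0 : ℝ) < (K + 1 : ℝ≥0) := hK
    obtain ⟨s, hs, hsx⟩ := hSd.exists_dist_lt x (div_pos hδ0 hK')
    refine ⟨f s, ⟨s, hs, rfl⟩, ((hX x s).intrinsicDist_le (by positivity)).trans_lt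
      (lt_of_le_of_lt ?_ hδε)⟩
    rw [← ENNReal.ofReal_coe_nnreal]
    apply ENNReal.ofReal_le_ofReal
    rw [lt_div_iff₀ hK'] at hsx
    rw [mul_comm]; exact hsx.le

theorem IsRTree.joinedBy {Y : Type u} [MetricSpace Y] (hY : IsRTree Y) (x y : Y) :
    JoinedBy x y (dist x y) := by
  obtain ⟨e⟩ := hY.1 x y
  have hφ : LipschitzWith 1 fun t : ℝ =>
      ((e.symm (Set.projIcc 0 (dist x y) dist_nonneg t) : metricSegment x y) : Y) := by
    have := (LipschitzWith.subtype_val (metricSegment x y)).comp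
      (e.symm.isometry.lipschitz.comp (LipschitzWith.projIcc (dist_nonneg (x := x) (y := y))))
    rw [one_mul, one_mul] at this
    exact this
  have hx : x ∈ metricSegment x y := by simp [metricSegment]
  have hy : y ∈ metricSegment x y := by simp [metricSegment]
  -- The isometry may reverse the segment, so the parameters of the ends are read off from `e`.
  have := JoinedBy.of_line hφ (a := e ⟨x, hx⟩) (b := e ⟨y, hy⟩) (r := dist x y) (by
    rw [← Real.dist_eq, ← Subtype.dist_eq, e.isometry.dist_eq, Subtype.dist_eq])
  simpa using this

/-- The two-point subset of the line with prescribed distance, mapped to two given points. -/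
theorem joinedBy_of_extension {Y : Type u} [MetricSpace Y] (x y : Y)
    (h : ∀ (B : Set (ULift.{u} ℝ)), B.Finite → ∀ f : B → Y, Isometry f →
      ∃ g : ULift.{u} ℝ → Y, LipschitzWith 1 g ∧ ∀ b : B, g b = f b) :
    JoinedBy x y (dist x y) := by
  classical
  let B : Set (ULift.{u} ℝ) := {⟨0⟩, ⟨dist x y⟩}
  let f : ULift.{u} ℝ → Y := fun t => if t = ⟨0⟩ then x else y
  have f0 : f ⟨0⟩ = x := if_pos rfl
  have f1 : f ⟨dist x y⟩ = y := by
    by_cases hxy : x = y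
    · subst hxy; simp [f]
    · have : (⟨dist x y⟩ : ULift.{u} ℝ) ≠ ⟨0⟩ := fun h =>
        hxy (dist_eq_zero.1 (congrArg ULift.down h))
      exact if_neg this
  obtain ⟨g, hg, hgf⟩ := h B (by simp [B]) (fun b => f b) (by
    refine Isometry.of_dist_eq ?_
    rintro ⟨a, ha⟩ ⟨b, hb⟩
    simp only [Subtype.dist_eq, ULift.dist_eq, Real.dist_eq]
    rcases ha with rfl | rfl <;> rcases hb with rfl | rfl
    · simp
    · rw [f0, f1]; simp
    · rw [f0, f1]; simp [dist_comm]
    · simp)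
  have hφ : LipschitzWith 1 fun t : ℝ => g ⟨t⟩ := LipschitzWith.of_dist_le_mul fun a b => by
    simpa [ULift.dist_eq] using hg.dist_le_mul ⟨a⟩ ⟨b⟩
  have := JoinedBy.of_line hφ (a := 0) (b := dist x y) (r := dist x y) (by simp)
  have e0 := hgf ⟨⟨0⟩, by simp [B]⟩
  have e1 := hgf ⟨⟨dist x y⟩, by simp [B]⟩
  simp only at e0 e1
  rwa [e0, e1, f0, f1] at this

theorem IsInjectiveMetricSpace.joinedBy {Y : Type u} [MetricSpace Y]
    (hY : IsInjectiveMetricSpace Y) (x y : Y) : JoinedBy x y (dist x y) :=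
  joinedBy_of_extension x y fun B _ f hf => hY _ B f hf.lipschitz

/-- The identity extends to a 1-Lipschitz retraction of the completion onto `Y`, which carries
limits into `Y`. -/
theorem IsInjectiveMetricSpace.completeSpace {Y : Type u} [MetricSpace Y]
    (hY : IsInjectiveMetricSpace Y) : CompleteSpace Y := by
  let ι : Y → UniformSpace.Completion Y := fun y => y
  have hι : Isometry ι := UniformSpace.Completion.coe_isometry
  let e := hι.isometryEquivOnRange
  obtain ⟨g, hg, hgf⟩ := hY (UniformSpace.Completion Y) (Set.range ι) e.symm
    e.symm.isometry.lipschitz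
  have hgι : ∀ y, g (ι y) = y := by
    intro y
    have := hgf (e y)
    rwa [e.symm_apply_apply] at this
  refine UniformSpace.complete_of_cauchySeq_tendsto fun v hv => ?_
  obtain ⟨a, ha⟩ := cauchySeq_tendsto_of_complete
    (hι.uniformContinuous.comp_cauchySeq hv)
  refine ⟨g a, ?_⟩
  have := (hg.continuous.tendsto a).comp ha
  refine this.congr fun n => hgι (v n)

/-! ### Embeddings into Urysohn spaces -/

theorem IsUrysohnSpace.nonempty {U : Type u} [MetricSpace U] (hU : IsUrysohnSpace U) :
    Nonempty U := by
  obtain ⟨g, -, -⟩ := hU.2.2 PUnit ∅ (fun x => x.2.elim) (fun x => x.2.elim)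
  exact ⟨g ⟨⟩⟩

/-- Isometric embeddings of finite subsets of a separable space into a Urysohn space extend. -/
theorem IsUrysohnSpace.exists_extension {U V : Type u} [MetricSpace U] [MetricSpace V]
    [TopologicalSpace.SeparableSpace V] [Nonempty V]
    (hU : IsUrysohnSpace U) (B : Set V) (hB : B.Finite) (f : B → U) (hf : Isometry f) :
    ∃ g : V → U, Isometry g ∧ ∀ b : B, g b = f b := by
  classical
  have hUne := hU.nonempty
  obtain ⟨hc, -, hU⟩ := hU
  obtain ⟨v, hv⟩ := TopologicalSpace.exists_dense_seq V
  let P : Set V → (V → U) → Prop := fun F g => ∀ x ∈ F, ∀ y ∈ F, dist (g x) (g y) = dist x y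
  have step : ∀ (F : Set V), F.Finite → ∀ (g : V → U), P F g → ∀ w : V,
      ∃ g', P (insert w F) g' ∧ ∀ x ∈ F, g' x = g x := by
    intro F hF g hg w
    have : Finite ↥(insert w F) := (hF.insert w).to_subtype
    obtain ⟨k, hk, hkg⟩ := hU ↥(insert w F) {x | x.1 ∈ F} (fun x => g x.1.1)
      (Isometry.of_dist_eq fun x y => hg _ x.2 _ y.2)
    refine ⟨fun x => if h : x ∈ insert w F then k ⟨x, h⟩ else g x, ?_, ?_⟩
    · intro x hx y hy
      simp only [dif_pos hx, dif_pos hy]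
      exact hk.dist_eq _ _
    · intro x hx
      have hx' : x ∈ insert w F := Set.mem_insert_of_mem _ hx
      simp only [dif_pos hx']
      exact hkg ⟨⟨x, hx'⟩, hx⟩
  -- Extend along a dense sequence one point at a time, then to all of `V` by completeness of `U`.
  let F : ℕ → Set V := fun n => B ∪ v '' Set.Iio n
  have hF : ∀ n, (F n).Finite := fun n => hB.union ((Set.finite_Iio n).image v)
  have hFs : ∀ n, F (n + 1) = insert (v n) (F n) := by
    intro n
    simp only [F]
    rw [← Set.union_insert, ← Set.image_insert_eq]
    congr 2
    ext i
    simp only [Set.mem_Iio, Set.mem_insert_iff]; omega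
  have h0 : ∃ g, P (F 0) g ∧ ∀ b : B, g b = f b := by
    refine ⟨fun x => if h : x ∈ B then f ⟨x, h⟩ else Classical.arbitrary U, ?_, ?_⟩
    · intro x hx y hy
      have hx : x ∈ B := by simpa [F] using hx
      have hy : y ∈ B := by simpa [F] using hy
      simp only [dif_pos hx, dif_pos hy]
      exact hf.dist_eq _ _
    · intro b
      simp only [dif_pos b.2]
  have hs : ∀ n g, P (F n) g → ∃ g', P (F (n + 1)) g' ∧ ∀ x ∈ F n, g' x = g x := by
    intro n g hg
    rw [hFs]
    exact step _ (hF n) g hg _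
  let seq : ∀ n : ℕ, {g // P (F n) g} := fun n => Nat.rec ⟨h0.choose, h0.choose_spec.1⟩
    (fun n g => ⟨(hs n g.1 g.2).choose, (hs n g.1 g.2).choose_spec.1⟩) n
  have hseq : ∀ n, ∀ x ∈ F n, (seq (n + 1)).1 x = (seq n).1 x :=
    fun n => (hs n (seq n).1 (seq n).2).choose_spec.2
  have hmono : Monotone F := monotone_nat_of_le_succ fun n => by
    rw [hFs]; exact Set.subset_insert _ _
  have hstab : ∀ n m, n ≤ m → ∀ x ∈ F n, (seq m).1 x = (seq n).1 x := by
    intro n m hnm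
    induction m, hnm using Nat.le_induction with
    | base => exact fun _ _ => rfl
    | succ m hm ih => exact fun x hx => (hseq m x (hmono hm hx)).trans (ih x hx)
  let D : Set V := ⋃ n, F n
  have hvD : ∀ n, v n ∈ D := fun n => Set.mem_iUnion.2 ⟨n + 1, by
    rw [hFs]; exact Set.mem_insert _ _⟩
  have hD : Dense D := hv.mono (by rintro _ ⟨n, rfl⟩; exact hvD n)
  have hDidx : ∀ x : D, ∃ n, x.1 ∈ F n := fun x => Set.mem_iUnion.1 x.2
  choose idx hidx using hDidx
  let k : D → U := fun x => (seq (idx x)).1 x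
  have hk : Isometry k := Isometry.of_dist_eq fun x y => by
    have hx := hstab _ _ (le_max_left (idx x) (idx y)) x.1 (hidx x)
    have hy := hstab _ _ (le_max_right (idx x) (idx y)) y.1 (hidx y)
    simp only [k]
    rw [← hx, ← hy, Subtype.dist_eq]
    exact (seq (max (idx x) (idx y))).2 _ (hmono (le_max_left _ _) (hidx x)) _
      (hmono (le_max_right _ _) (hidx y))
  have hdi : IsDenseInducing (Subtype.val : D → V) :=
    ⟨Topology.IsInducing.subtypeVal, hD.denseRange_val⟩
  have hui : IsUniformInducing (Subtype.val : D → V) := isUniformEmbedding_subtype_val.1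
  let g := hdi.extend k
  have hgc : UniformContinuous g :=
    uniformContinuous_uniformly_extend hui hD.denseRange_val hk.uniformContinuous
  have hgk : ∀ x : D, g x = k x :=
    fun x => hdi.extend_eq hk.continuous x
  refine ⟨g, Isometry.of_dist_eq fun x y => ?_, fun b => ?_⟩
  · have hcl : IsClosed {p : V × V | dist (g p.1) (g p.2) = dist p.1 p.2} :=
      isClosed_eq ((hgc.continuous.comp continuous_fst).dist (hgc.continuous.comp continuous_snd))
        (continuous_fst.dist continuous_snd)
    have hsub : D ×ˢ D ⊆ {p : V × V | dist (g p.1) (g p.2) = dist p.1 p.2} := by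
      rintro ⟨a, b⟩ ⟨ha, hb⟩
      have := hk.dist_eq ⟨a, ha⟩ ⟨b, hb⟩
      rw [← hgk, ← hgk] at this
      exact this
    have := (hD.prod hD).closure_eq ▸ closure_minimal hsub hcl
    exact this (Set.mem_univ (x, y))
  · have hb0 : b.1 ∈ F 0 := Or.inl b.2
    have hbD : b.1 ∈ D := Set.mem_iUnion.2 ⟨0, hb0⟩
    rw [hgk ⟨b.1, hbD⟩]
    simp only [k]
    rw [hstab 0 _ (Nat.zero_le _) _ hb0]
    exact h0.choose_spec.2 b

theorem IsUrysohnSpace.joinedBy {U : Type u} [MetricSpace U] (hU : IsUrysohnSpace U) (x y : U) :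
    JoinedBy x y (dist x y) :=
  joinedBy_of_extension x y fun B hB f hf => by
    have : TopologicalSpace.SeparableSpace (ULift.{u} ℝ) :=
      (ULift.up_surjective.denseRange.separableSpace continuous_uliftUp)
    obtain ⟨g, hg, hgf⟩ := hU.exists_extension B hB f hf
    exact ⟨g, hg.lipschitz, hgf⟩

/-- A separable injective metric space is a `1`-Lipschitz image of every Urysohn space. -/
theorem IsUrysohnSpace.isOneLipschitzImage {U Y : Type u} [MetricSpace U] [MetricSpace Y]
    [TopologicalSpace.SeparableSpace Y] [Nonempty Y] (hU : IsUrysohnSpace U)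
    (hY : IsInjectiveMetricSpace Y) : IsOneLipschitzImage Y U := by
  -- Extending from the empty set embeds `Y`; injectivity then gives a retraction onto the copy.
  obtain ⟨ι, hι, -⟩ := hU.exists_extension (V := Y) ∅ Set.finite_empty (fun x => x.2.elim)
    (fun x => x.2.elim)
  let e := hι.isometryEquivOnRange
  obtain ⟨g, hg, hgf⟩ := hY U (Set.range ι) e.symm e.symm.isometry.lipschitz
  refine ⟨g, hg, fun y => ⟨ι y, ?_⟩⟩
  have := hgf (e y)
  rwa [e.symm_apply_apply] at this

/-! ### Infinite paths along convergent sequences -/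

section InfinitePath

open Filter Topology

variable {X : Type u} [MetricSpace X]

open Classical in
/-- A chosen path of length `r` from `x` to `y`. -/
noncomputable def edgePath (x y : X) (r : ℝ) : ℝ → X :=
  if h : JoinedBy x y r then h.choose else fun _ => x

theorem lipschitzWith_edgePath {x y : X} {r : ℝ} (h : JoinedBy x y r) :
    LipschitzWith 1 (edgePath x y r) := by
  rw [edgePath, dif_pos h]; exact h.choose_spec.1

theorem edgePath_of_nonpos {x y : X} {r : ℝ} (h : JoinedBy x y r) {t : ℝ} (ht : t ≤ 0) :
    edgePath x y r t = x := by
  rw [edgePath, dif_pos h]; exact h.choose_spec.2.1 t ht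

theorem edgePath_of_ge {x y : X} {r : ℝ} (h : JoinedBy x y r) {t : ℝ} (ht : r ≤ t) :
    edgePath x y r t = y := by
  rw [edgePath, dif_pos h]; exact h.choose_spec.2.2 t ht

/-- The path from `o` at depth `l` through the points `w k` at depth `2⁻ᵏ`, for `k ≤ n`. -/
noncomputable def descend (o : X) (l : ℝ) (w : ℕ → X) : ℕ → ℝ → X
  | 0 => fun s => edgePath o (w 0) (l - 1) (l - s)
  | n + 1 => fun s => if s ≤ (1 / 2) ^ n then
      edgePath (w n) (w (n + 1)) ((1 / 2) ^ (n + 1)) ((1 / 2) ^ n - s) else descend o l w n s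

theorem descend_congr {o : X} {l : ℝ} {w w' : ℕ → X} {n : ℕ} (h : ∀ k ≤ n, w k = w' k) :
    descend o l w n = descend o l w' n := by
  induction n with
  | zero => simp only [descend, h 0 le_rfl]
  | succ n ih =>
    simp only [descend, ih fun k hk => h k (by omega), h n (by omega), h (n + 1) le_rfl]

/-- The infinite path through `o` at depth `l` and all the points `w k` at depth `2⁻ᵏ`. -/
noncomputable def branchPath [Nonempty X] (o : X) (l : ℝ) (w : ℕ → X) (s : ℝ) : X :=
  limUnder atTop fun n => descend o l w n s

variable {o : X} {l : ℝ} {w : ℕ → X} (h0 : JoinedBy o (w 0) (l - 1))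
  (hw : ∀ n, JoinedBy (w n) (w (n + 1)) ((1 / 2) ^ (n + 1)))
include h0 hw

theorem descend_of_le {n : ℕ} {s : ℝ} (hs : s ≤ (1 / 2) ^ n) : descend o l w n s = w n := by
  cases n with
  | zero =>
    rw [pow_zero] at hs
    exact edgePath_of_ge h0 (by linarith)
  | succ n =>
    have h1 : ((1 : ℝ) / 2) ^ (n + 1) = (1 / 2) ^ n / 2 := by rw [pow_succ]; ring
    have h2 : (0 : ℝ) < (1 / 2) ^ n := by positivity
    refine (if_pos (by linarith)).trans ?_
    exact edgePath_of_ge (hw n) (by linarith)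

theorem lipschitzWith_descend (n : ℕ) : LipschitzWith 1 (descend o l w n) := by
  have hsub : ∀ (c : ℝ) (φ : ℝ → X), LipschitzWith 1 φ → LipschitzWith 1 fun s => φ (c - s) := by
    intro c φ hφ
    refine LipschitzWith.of_dist_le_mul fun a b => ?_
    have := hφ.dist_le_mul (c - a) (c - b)
    rwa [dist_sub_left] at this
  induction n with
  | zero => exact hsub _ _ (lipschitzWith_edgePath h0)
  | succ n ih =>
    refine (hsub _ _ (lipschitzWith_edgePath (hw n))).glue ih ?_
    rw [edgePath_of_nonpos (hw n) (by simp), descend_of_le h0 hw le_rfl]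

theorem descend_stable {n m : ℕ} (hnm : n ≤ m) {s : ℝ} (hs : (1 / 2) ^ n ≤ s) :
    descend o l w m s = descend o l w n s := by
  induction m, hnm using Nat.le_induction with
  | base => rfl
  | succ m hm ih =>
    have h1 : ((1 : ℝ) / 2) ^ m ≤ s :=
      (pow_le_pow_of_le_one (by norm_num) (by norm_num) hm).trans hs
    rw [← ih]
    simp only [descend]
    split_ifs with h
    · rw [edgePath_of_nonpos (hw m) (by linarith), descend_of_le h0 hw h]
    · rfl

variable [Nonempty X]

theorem branchPath_eq_descend {n : ℕ} {s : ℝ} (hs : (1 / 2) ^ n ≤ s) :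
    branchPath o l w s = descend o l w n s := by
  refine (tendsto_const_nhds.congr' ?_).limUnder_eq
  filter_upwards [eventually_ge_atTop n] with m hm
  exact (descend_stable h0 hw hm hs).symm

theorem branchPath_zero {p : X} (hp : Tendsto w atTop (𝓝 p)) : branchPath o l w 0 = p :=
  (hp.congr fun _ => (descend_of_le h0 hw (by positivity)).symm).limUnder_eq

/-- At positive depth the truncated paths stabilise; at depth `0` they run through `w`, where `hp`
replaces completeness of `X`. -/
theorem tendsto_descend {p : X} (hp : Tendsto w atTop (𝓝 p)) {s : ℝ} (hs : 0 ≤ s) :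
    Tendsto (fun n => descend o l w n s) atTop (𝓝 (branchPath o l w s)) := by
  rcases hs.eq_or_lt with rfl | hs
  · rw [branchPath_zero h0 hw hp]
    exact hp.congr fun _ => (descend_of_le h0 hw (by positivity)).symm
  · obtain ⟨n, hn⟩ := exists_pow_lt_of_lt_one hs (by norm_num : (1 / 2 : ℝ) < 1)
    rw [branchPath_eq_descend h0 hw hn.le]
    refine tendsto_const_nhds.congr' ?_
    filter_upwards [eventually_ge_atTop n] with m hm
    exact (descend_stable h0 hw hm hn.le).symm

theorem dist_branchPath_le {p : X} (hp : Tendsto w atTop (𝓝 p)) {s t : ℝ} (hs : 0 ≤ s)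
    (ht : 0 ≤ t) : dist (branchPath o l w s) (branchPath o l w t) ≤ |s - t| := by
  refine le_of_tendsto' ((tendsto_descend h0 hw hp hs).dist (tendsto_descend h0 hw hp ht))
    fun n => ?_
  simpa [Real.dist_eq] using (lipschitzWith_descend h0 hw n).dist_le_mul s t

theorem branchPath_of_ge (hl : 1 ≤ l) {s : ℝ} (hs : l ≤ s) : branchPath o l w s = o := by
  rw [branchPath_eq_descend h0 hw (n := 0) (by rw [pow_zero]; linarith)]
  exact edgePath_of_nonpos h0 (by linarith)

end InfinitePath

/-! ### An ultrametric on sequences -/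

section Sequences

variable {D : Type u} (m : D → ℕ)

open Classical in
/-- The binary logarithm of the distance of two sequences. -/
noncomputable def seqExp (x y : ℕ → D) : ℤ :=
  if x 0 = y 0 then 1 - (PiNat.firstDiff x y : ℤ) else max (m (x 0) : ℤ) (m (y 0)) + 1

open Classical in
/-- The ultrametric on sequences for which sequences with distinct first terms are far apart,
depending on the weights `m` of these. -/
noncomputable def seqDist (x y : ℕ → D) : ℝ :=
  if x = y then 0 else 2 ^ seqExp m x y

theorem seqDist_nonneg (x y : ℕ → D) : 0 ≤ seqDist m x y := by
  unfold seqDist; split_ifs <;> positivity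

theorem seqDist_comm (x y : ℕ → D) : seqDist m x y = seqDist m y x := by
  unfold seqDist seqExp
  rw [PiNat.firstDiff_comm, max_comm, eq_comm (a := x), eq_comm (a := x 0)]

theorem one_le_firstDiff {x y : ℕ → D} (hxy : x ≠ y) (h : x 0 = y 0) :
    1 ≤ PiNat.firstDiff x y := by
  by_contra hlt
  have h0 : PiNat.firstDiff x y = 0 := by omega
  have := PiNat.apply_firstDiff_ne hxy
  rw [h0] at this
  exact this h

/-- For distinct sequences the exponent is at most `0` if the first terms agree and at least `1`
otherwise, so the two regimes do not interfere. -/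
theorem seqExp_ultra {x y z : ℕ → D} (hxy : x ≠ y) (hyz : y ≠ z) (hxz : x ≠ z) :
    seqExp m x z ≤ max (seqExp m x y) (seqExp m y z) := by
  have h1 := PiNat.min_firstDiff_le x y z hxz
  have h2 := fun h => one_le_firstDiff hxz h
  have h3 := fun h => one_le_firstDiff hxy h
  have h4 := fun h => one_le_firstDiff hyz h
  unfold seqExp
  by_cases a : x 0 = y 0 <;> by_cases b : y 0 = z 0
  · simp only [if_pos a, if_pos b, if_pos (a.trans b)]; omega
  · rw [a, if_neg b, if_neg b, if_pos rfl]; omega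
  · rw [← b, if_neg a, if_neg a, if_pos rfl]; omega
  · rw [if_neg a, if_neg b]
    split_ifs <;> omega

theorem seqDist_ultra (x y z : ℕ → D) :
    seqDist m x z ≤ max (seqDist m x y) (seqDist m y z) := by
  by_cases hxz : x = z
  · rw [seqDist, if_pos hxz]; exact le_max_of_le_left (seqDist_nonneg _ _ _)
  by_cases hxy : x = y
  · rw [hxy]; exact le_max_right _ _
  by_cases hyz : y = z
  · rw [hyz]; exact le_max_left _ _
  simp only [seqDist, if_neg hxz, if_neg hxy, if_neg hyz]
  rcases le_max_iff.1 (seqExp_ultra m hxy hyz hxz) with h | h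
  · exact le_max_of_le_left (zpow_le_zpow_right₀ (by norm_num) h)
  · exact le_max_of_le_right (zpow_le_zpow_right₀ (by norm_num) h)

theorem two_zpow_one_sub (n : ℕ) : (2 : ℝ) ^ (1 - (n : ℤ)) = 2 * (1 / 2) ^ n := by
  rw [zpow_sub₀ (by norm_num), zpow_one, zpow_natCast, one_div, inv_pow, div_eq_mul_inv]

theorem agree_of_seqDist_lt {x y : ℕ → D} {n : ℕ} (h : seqDist m x y < 2 * (1 / 2) ^ n) :
    ∀ k ≤ n, x k = y k := by
  by_cases hxy : x = y
  · simp [hxy]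
  rw [seqDist, if_neg hxy, ← two_zpow_one_sub, zpow_lt_zpow_iff_right₀ (by norm_num)] at h
  unfold seqExp at h
  split_ifs at h
  · exact fun k hk => PiNat.apply_eq_of_lt_firstDiff (by omega)
  · omega

theorem seqDist_le_of_agree {x y : ℕ → D} {n : ℕ} (h : ∀ k ≤ n, x k = y k) :
    seqDist m x y ≤ (1 / 2) ^ n := by
  unfold seqDist
  split_ifs with hxy
  · positivity
  have h1 : n < PiNat.firstDiff x y := by
    by_contra hlt
    exact PiNat.apply_firstDiff_ne hxy (h _ (not_lt.1 hlt))
  have h2 : ((1 : ℝ) / 2) ^ n = 2 ^ (1 - ((n + 1 : ℕ) : ℤ)) := by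
    rw [two_zpow_one_sub, pow_succ]; ring
  rw [h2]
  refine zpow_le_zpow_right₀ (by norm_num) ?_
  rw [seqExp, if_pos (h 0 (by omega))]
  omega

/-- The ultrametric on a set of sequences. -/
noncomputable def seqUltraDist (P : (ℕ → D) → Prop) : UltraDist {x // P x} where
  δ x y := seqDist m x.1 y.1
  self _ := if_pos rfl
  symm _ _ := seqDist_comm m _ _
  ultra _ _ _ := seqDist_ultra m _ _ _

/-- For `s = 0` the terms stabilise coordinatewise, and `hP`, closedness under finite agreement,
puts the limit in `P`. For `s > 0` the nonzero distances are powers of two, so none lies strictly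
between `s` and the next power above it: a late term of the sequence itself serves as limit. -/
theorem seqUltraDist_isComplete {P : (ℕ → D) → Prop}
    (hP : ∀ y, (∀ n, ∃ x, P x ∧ ∀ k ≤ n, x k = y k) → P y) :
    (seqUltraDist m P).IsComplete := by
  intro s σ hs hσ
  change ∀ ε > 0, ∃ N, ∀ k ≥ N, ∀ l ≥ N, seqDist m (σ k).1 (σ l).1 ≤ s + ε at hσ
  change ∃ τ : {x // P x}, ∀ ε > 0, ∃ N, ∀ k ≥ N, seqDist m (σ k).1 τ.1 ≤ s + ε
  rcases hs.eq_or_lt with rfl | hs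
  · have hN : ∀ n : ℕ, ∃ N, ∀ k ≥ N, ∀ l ≥ N, ∀ j ≤ n, (σ k).1 j = (σ l).1 j := by
      intro n
      have hpos : (0 : ℝ) < (1 / 2) ^ n := by positivity
      obtain ⟨N, hN⟩ := hσ _ hpos
      exact ⟨N, fun k hk l hl => agree_of_seqDist_lt m
        ((hN k hk l hl).trans_lt (by linarith))⟩
    choose N hN using hN
    let τ : ℕ → D := fun j => (σ (N j)).1 j
    have hτ : ∀ n, ∀ k ≥ N n, ∀ j ≤ n, (σ k).1 j = τ j := by
      intro n k hk j hj
      rw [hN n k hk (max (N n) (N j)) (le_max_left _ _) j hj]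
      exact hN j _ (le_max_right _ _) _ le_rfl j le_rfl
    refine ⟨⟨τ, hP τ fun n => ⟨_, (σ (N n)).2, hτ n _ le_rfl⟩⟩, fun ε hε => ?_⟩
    obtain ⟨n, hn⟩ := exists_pow_lt_of_lt_one hε (by norm_num : (1 / 2 : ℝ) < 1)
    exact ⟨N n, fun k hk => (seqDist_le_of_agree m (hτ n k hk)).trans (by linarith)⟩
  · obtain ⟨e, he1, he2⟩ := exists_mem_Ico_zpow hs (by norm_num : (1 : ℝ) < 2)
    have hgap : ∀ x y : ℕ → D, seqDist m x y < 2 ^ (e + 1) → seqDist m x y ≤ s := by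
      intro x y h
      unfold seqDist at h ⊢
      split_ifs at h ⊢
      · exact hs.le
      · rw [zpow_lt_zpow_iff_right₀ (by norm_num)] at h
        exact (zpow_le_zpow_right₀ (by norm_num) (by omega)).trans he1
    obtain ⟨N, hN⟩ := hσ ((2 ^ (e + 1) - s) / 2) (by linarith)
    refine ⟨σ N, fun ε hε => ⟨N, fun k hk => ?_⟩⟩
    have := hgap _ _ ((hN k hk N le_rfl).trans_lt (by linarith))
    linarith

/-- One member of `P` is chosen for each finite prefix that occurs. -/
theorem exists_countable_dense_seqUltraDist [Countable D] (P : (ℕ → D) → Prop) :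
    ∃ C : Set {x // P x}, C.Countable ∧
      ∀ x, ∀ ε > 0, ∃ c ∈ C, (seqUltraDist m P).δ x c ≤ ε := by
  classical
  rcases isEmpty_or_nonempty {x // P x} with hE | hE
  · exact ⟨∅, Set.countable_empty, fun x => (hE.false x).elim⟩
  let c : (Σ n : ℕ, Fin (n + 1) → D) → {x // P x} := fun v =>
    if h : ∃ x : {x // P x}, ∀ k : Fin (v.1 + 1), x.1 k = v.2 k then h.choose
    else Classical.arbitrary _
  refine ⟨Set.range c, Set.countable_range c, fun x ε hε => ?_⟩
  obtain ⟨n, hn⟩ := exists_pow_lt_of_lt_one hε (by norm_num : (1 / 2 : ℝ) < 1)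
  let v : Σ n : ℕ, Fin (n + 1) → D := ⟨n, fun k => x.1 k⟩
  refine ⟨c v, ⟨v, rfl⟩, ?_⟩
  have h : ∃ y : {x // P x}, ∀ k : Fin (v.1 + 1), y.1 k = v.2 k := ⟨x, fun _ => rfl⟩
  have hc : c v = h.choose := dif_pos h
  refine (seqDist_le_of_agree m fun k hk => ?_).trans hn.le
  rw [hc]
  exact (h.choose_spec ⟨k, Nat.lt_succ_of_le hk⟩).symm

end Sequences

/-! ### The tree over an analytic space -/

section Construction

open Filter Topology

variable {X Z : Type u} [MetricSpace X] [MetricSpace Z]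

/-- Sequences of pairs whose second components converge in `Z` and whose first components
converge along a path of finite length to the image of this limit. -/
structure IsConvergentBranch (g : Z → X) {D : Type u} (a : D → X) (b : D → Z) (x : ℕ → D) :
    Prop where
  joined : ∀ n, JoinedBy (a (x n)) (a (x (n + 1))) ((1 / 2) ^ (n + 1))
  dist_le : ∀ n, dist (b (x n)) (b (x (n + 1))) ≤ 1 * (1 / 2) ^ n
  tendsto : ∃ z, Tendsto (fun n => b (x n)) atTop (𝓝 z) ∧
    Tendsto (fun n => a (x n)) atTop (𝓝 (g z))

/-- The approximating branches have limits `ζ n` that tend to `z`, because the `Z`-terms converge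
geometrically. Then `g (ζ n)` tends to `g z` by continuity, and it is within `2⁻ⁿ` of `a (y n)`. -/
theorem IsConvergentBranch.of_agree [CompleteSpace Z] {g : Z → X} (hg : Continuous g)
    {D : Type u} {a : D → X} {b : D → Z} {y : ℕ → D}
    (hy : ∀ n, ∃ x, IsConvergentBranch g a b x ∧ ∀ k ≤ n, x k = y k) :
    IsConvergentBranch g a b y := by
  have hb : ∀ n, dist (b (y n)) (b (y (n + 1))) ≤ 1 * (1 / 2) ^ n := by
    intro n
    obtain ⟨x, hx, hxy⟩ := hy (n + 1)
    rw [← hxy n (by omega), ← hxy (n + 1) le_rfl]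
    exact hx.dist_le n
  refine ⟨fun n => ?_, hb, ?_⟩
  · obtain ⟨x, hx, hxy⟩ := hy (n + 1)
    rw [← hxy n (by omega), ← hxy (n + 1) le_rfl]
    exact hx.joined n
  obtain ⟨z, hz⟩ := cauchySeq_tendsto_of_complete
    (cauchySeq_of_le_geometric (1 / 2) 1 (by norm_num) hb)
  refine ⟨z, hz, ?_⟩
  choose x hx hxy using hy
  choose ζ hζ using fun n => (hx n).tendsto
  have h1 : ∀ n, dist (b (y n)) (ζ n) ≤ 1 * (1 / 2) ^ n / (1 - 1 / 2) := by
    intro n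
    rw [← hxy n n le_rfl]
    exact dist_le_of_le_geometric_of_tendsto (1 / 2) 1 (by norm_num) (hx n).dist_le (hζ n).1 n
  have h2 : ∀ n, dist (a (y n)) (g (ζ n)) ≤ 1 / 2 * (1 / 2) ^ n / (1 - 1 / 2) := by
    intro n
    rw [← hxy n n le_rfl]
    refine dist_le_of_le_geometric_of_tendsto (1 / 2) (1 / 2) (by norm_num) (fun k => ?_)
      (hζ n).2 n
    refine ((hx n).joined k |>.dist_le (by positivity)).trans (le_of_eq ?_)
    rw [pow_succ]; ring
  have hpow : ∀ c : ℝ, Tendsto (fun n : ℕ => c * (1 / 2 : ℝ) ^ n / (1 - 1 / 2)) atTop (𝓝 0) := by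
    intro c
    have := ((tendsto_pow_atTop_nhds_zero_of_lt_one (r := (1 / 2 : ℝ)) (by norm_num)
      (by norm_num)).const_mul c).div_const (1 - 1 / 2)
    simpa using this
  have hζz : Tendsto ζ atTop (𝓝 z) := hz.congr_dist
    (squeeze_zero (fun _ => dist_nonneg) h1 (hpow _))
  refine ((hg.tendsto z).comp hζz).congr_dist
    (squeeze_zero (fun _ => dist_nonneg) (fun n => ?_) (hpow (1 / 2)))
  rw [dist_comm]
  exact h2 n

/-- An analytic Lipschitz connected space with separable intrinsic metric is the `1`-Lipschitz
image of a tree. -/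
theorem exists_tree_of_analytic [Nonempty X] (hA : IsAnalyticSpace X)
    (hL : IsLipschitzConnected X) (hS : IntrinsicMetricSeparable X) :
    ∃ (Y : Type u) (_ : MetricSpace Y), TopologicalSpace.SeparableSpace Y ∧ CompleteSpace Y ∧
      IsRTree Y ∧ IsInjectiveMetricSpace Y ∧ IsOneLipschitzImage X Y := by
  obtain ⟨Z, _, _, _, g, hg, hgs⟩ := hA
  obtain ⟨S, hSc, hSd⟩ := hS
  obtain ⟨V, hVc, hVd⟩ := TopologicalSpace.exists_countable_dense Z
  have := hSc.to_subtype
  have := hVc.to_subtype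
  let D : Type u := ↥S × ↥V
  let a : D → X := fun d => d.1
  let b : D → Z := fun d => d.2
  let o : X := Classical.arbitrary X
  -- The path runs from `o` at depth `2 ^ (m + 1)` to the first term at depth `1`, hence the `- 1`.
  have hm : ∀ d : D, ∃ m : ℕ, JoinedBy o (a d) (2 ^ (m + 1) - 1) := by
    intro d
    obtain ⟨K, f, hf⟩ := hL o (a d)
    obtain ⟨m, hm⟩ := pow_unbounded_of_one_lt ((K : ℝ) + 2) (by norm_num : (1 : ℝ) < 2)
    have hK : (0 : ℝ) ≤ K := K.2
    have h2 : (2 : ℝ) ^ (m + 1) = 2 ^ m * 2 := pow_succ _ _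
    exact ⟨m, hf.joinedBy (by linarith) (by linarith)⟩
  choose m hm using hm
  let P : (ℕ → D) → Prop := IsConvergentBranch g a b
  let Δ := seqUltraDist m P
  have hcompl : Δ.IsComplete := seqUltraDist_isComplete m fun y hy => .of_agree hg hy
  let l : D → ℝ := fun d => 2 ^ (m d + 1)
  have hl : ∀ d, 1 ≤ l d := fun d => one_le_pow₀ (by norm_num)
  let F : {x // P x} → ℝ → X := fun x => branchPath o (l (x.1 0)) fun n => a (x.1 n)
  have h0 : ∀ x : {x // P x}, JoinedBy o (a (x.1 0)) (l (x.1 0) - 1) := fun x => hm _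
  have hw : ∀ (x : {x // P x}) (n), JoinedBy (a (x.1 n)) (a (x.1 (n + 1))) ((1 / 2) ^ (n + 1)) :=
    fun x => x.2.joined
  have hlip : ∀ (x : {x // P x}) (s t : ℝ), 0 ≤ s → 0 ≤ t → dist (F x s) (F x t) ≤ |s - t| := by
    intro x s t hs ht
    obtain ⟨z, -, hz⟩ := x.2.tendsto
    exact dist_branchPath_le (h0 x) (hw x) hz hs ht
  -- The exponents in `seqExp` are calibrated for this: agreement through term `n` gives equal rays
  -- above depth `2⁻ⁿ`, and with different first terms both rays have reached `o`.
  have hmerge : ∀ (x y : {x // P x}) (s : ℝ), Δ.δ x y ≤ s → F x s = F y s := by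
    intro x y s hs
    change seqDist m x.1 y.1 ≤ s at hs
    by_cases hxy : x.1 = y.1
    · rw [Subtype.ext hxy]
    rw [seqDist, if_neg hxy, seqExp] at hs
    split_ifs at hs with h
    · have h1 := one_le_firstDiff hxy h
      obtain ⟨n, hn⟩ := Nat.exists_eq_add_of_le' h1
      have hs' : (1 / 2) ^ n ≤ s := by
        rw [hn, two_zpow_one_sub, pow_succ] at hs; linarith
      simp only [F]
      rw [branchPath_eq_descend (h0 x) (hw x) hs', branchPath_eq_descend (h0 y) (hw y) hs', h]
      refine congrFun (descend_congr fun k hk => congrArg a ?_) s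
      exact PiNat.apply_eq_of_lt_firstDiff (by omega)
    · have key : ∀ d : D, (m d : ℤ) ≤ max (m (x.1 0) : ℤ) (m (y.1 0)) → l d ≤ s := by
        intro d hd
        refine le_trans ?_ hs
        simp only [l]
        rw [← zpow_natCast]
        exact zpow_le_zpow_right₀ (by norm_num) (by push_cast; omega)
      simp only [F]
      rw [branchPath_of_ge (h0 x) (hw x) (hl _) (key _ (le_max_left _ _)),
        branchPath_of_ge (h0 y) (hw y) (hl _) (key _ (le_max_right _ _))]
  let G : PreBranchTree Δ → X := fun p => F p.branch p.depth
  have hG : ∀ p q, dist (G p) (G q) ≤ dist p q := by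
    intro p q
    have h1 := PreBranchTree.le_meet_left p q
    have h2 := PreBranchTree.le_meet_right p q
    have hp : (0 : ℝ) ≤ p.depth := p.depth.2
    have hq : (0 : ℝ) ≤ q.depth := q.depth.2
    -- Both points are compared with the common value of the two rays at the merging depth.
    have h3 := hlip p.branch p.depth (PreBranchTree.meet p q) hp (hp.trans h1)
    have h4 := hlip q.branch (PreBranchTree.meet p q) q.depth (hq.trans h2) hq
    rw [← hmerge p.branch q.branch _ (PreBranchTree.dist_le_meet p q)] at h4
    rw [abs_of_nonpos (by linarith)] at h3
    rw [abs_of_nonneg (by linarith)] at h4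
    have h5 := dist_triangle (G p) (F p.branch (PreBranchTree.meet p q)) (G q)
    rw [PreBranchTree.dist_def]
    linarith
  have hsurj : ∀ p : X, ∃ x : {x // P x}, F x 0 = p := by
    intro p
    obtain ⟨z, rfl⟩ := hgs p
    -- Consecutive terms are joined through `g z`; the exponents `n + 3` here and `n + 2` below
    -- leave room for the sum of two errors.
    have hs : ∀ n : ℕ, ∃ s : S, JoinedBy (g z) s.1 ((1 / 2) ^ (n + 3)) := by
      intro n
      obtain ⟨s, hs, h⟩ := hSd (g z) (ENNReal.ofReal ((1 / 2) ^ (n + 3)))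
        (ENNReal.ofReal_pos.2 (by positivity))
      exact ⟨⟨s, hs⟩, joinedBy_of_intrinsicDist_lt h⟩
    have hv : ∀ n : ℕ, ∃ v : V, dist z v.1 < (1 / 2) ^ (n + 2) := by
      intro n
      obtain ⟨v, hv, h⟩ := hVd.exists_dist_lt z (ε := (1 / 2) ^ (n + 2)) (by positivity)
      exact ⟨⟨v, hv⟩, h⟩
    choose s hs using hs
    choose v hv using hv
    have hpow : ∀ n : ℕ, (0 : ℝ) < (1 / 2) ^ n := fun n => by positivity
    have hlim : Tendsto (fun n : ℕ => (1 / 2 : ℝ) ^ n) atTop (𝓝 0) :=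
      tendsto_pow_atTop_nhds_zero_of_lt_one (by norm_num) (by norm_num)
    have ht : Tendsto (fun n => ((s n : S) : X)) atTop (𝓝 (g z)) := by
      rw [tendsto_iff_dist_tendsto_zero]
      refine squeeze_zero (fun _ => dist_nonneg) (fun n => ?_) hlim
      rw [dist_comm]
      refine ((hs n).dist_le (by positivity)).trans ?_
      exact pow_le_pow_of_le_one (by norm_num) (by norm_num) (by omega)
    have hbranch : P fun n => (s n, v n) := by
      refine ⟨fun n => ?_, fun n => ?_, z, ?_, ht⟩
      · refine ((hs n).symm.trans (hs (n + 1)) (by positivity) (by positivity)).mono ?_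
        have := hpow n
        simp only [pow_succ]; linarith
      · have h1 := dist_triangle_left ((v n : V) : Z) (v (n + 1)) z
        have h2 := hv n
        have h3 := hv (n + 1)
        have := hpow n
        simp only [pow_succ] at h2 h3
        simp only [b]
        linarith
      · rw [tendsto_iff_dist_tendsto_zero]
        refine squeeze_zero (fun _ => dist_nonneg) (fun n => ?_) hlim
        rw [dist_comm]
        refine (hv n).le.trans ?_
        exact pow_le_pow_of_le_one (by norm_num) (by norm_num) (by omega)
    exact ⟨⟨_, hbranch⟩, branchPath_zero (h0 ⟨_, hbranch⟩) (hw ⟨_, hbranch⟩) ht⟩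
  have : Nonempty {x // P x} := ⟨(hsurj o).choose⟩
  obtain ⟨C, hC, hCd⟩ := exists_countable_dense_seqUltraDist m P
  refine ⟨BranchTree Δ, inferInstance, BranchTree.separableSpace hC hCd,
    BranchTree.completeSpace hcompl, BranchTree.isRTree Δ,
    BranchTree.isInjectiveMetricSpace hcompl,
    SeparationQuotient.lift G fun p q hpq => ?_, ?_, fun p => ?_⟩
  · have := hG p q
    rw [Metric.inseparable_iff.1 hpq] at this
    exact dist_le_zero.1 this
  · refine LipschitzWith.of_dist_le_mul fun p q => ?_
    obtain ⟨p, rfl⟩ := SeparationQuotient.surjective_mk p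
    obtain ⟨q, rfl⟩ := SeparationQuotient.surjective_mk q
    rw [SeparationQuotient.dist_mk, NNReal.coe_one, one_mul]
    exact hG p q
  · obtain ⟨x, hx⟩ := hsurj p
    exact ⟨SeparationQuotient.mk ⟨x, 0⟩, hx⟩

end Construction

/-! ### The equivalence -/

theorem theorem1p4 (X : Type u) [MetricSpace X] [Nonempty X] :
    List.TFAE
      [ -- Lipschitz image of a separable injective metric space
        ∃ (Y : Type u) (_ : MetricSpace Y), TopologicalSpace.SeparableSpace Y ∧
          IsInjectiveMetricSpace Y ∧ IsLipschitzImage X Y,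
        -- Lipschitz image of a separable complete ℝ-tree
        ∃ (Y : Type u) (_ : MetricSpace Y), TopologicalSpace.SeparableSpace Y ∧
          CompleteSpace Y ∧ IsRTree Y ∧ IsLipschitzImage X Y,
        -- 1-Lipschitz image of the Urysohn universal space, in the existential form
        ∃ (U : Type u) (_ : MetricSpace U), IsUrysohnSpace U ∧ IsOneLipschitzImage X U,
        -- 1-Lipschitz image of the Urysohn universal space, in the universal form
        ∀ (U : Type u) [MetricSpace U], IsUrysohnSpace U → IsOneLipschitzImage X U,
        -- analytic, Lipschitz connected, with separable intrinsic metric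
        IsAnalyticSpace X ∧ IsLipschitzConnected X ∧ IntrinsicMetricSeparable X ] := by
  tfae_have 1 → 5 := by
    rintro ⟨Y, _, _, hY, h⟩
    have := hY.completeSpace
    exact analytic_lipschitzConnected_of_geodesic hY.joinedBy h
  tfae_have 2 → 5 := by
    rintro ⟨Y, _, _, _, hY, h⟩
    exact analytic_lipschitzConnected_of_geodesic hY.joinedBy h
  tfae_have 3 → 5 := by
    rintro ⟨U, _, hU, f, hf, hs⟩
    have := hU.1
    have := hU.2.1
    exact analytic_lipschitzConnected_of_geodesic hU.joinedBy ⟨1, f, hf, hs⟩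
  tfae_have 5 → 1 := by
    rintro ⟨hA, hL, hS⟩
    obtain ⟨Y, _, h1, -, -, h2, f, hf, hs⟩ := exists_tree_of_analytic hA hL hS
    exact ⟨Y, _, h1, h2, 1, f, hf, hs⟩
  tfae_have 5 → 2 := by
    rintro ⟨hA, hL, hS⟩
    obtain ⟨Y, _, h1, h2, h3, -, f, hf, hs⟩ := exists_tree_of_analytic hA hL hS
    exact ⟨Y, _, h1, h2, h3, 1, f, hf, hs⟩
  tfae_have 5 → 4 := by
    rintro ⟨hA, hL, hS⟩ U _ hU
    obtain ⟨Y, _, _, -, -, h2, f, hf, hs⟩ := exists_tree_of_analytic hA hL hS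
    have : Nonempty Y := ⟨(hs (Classical.arbitrary X)).choose⟩
    obtain ⟨r, hr, hrs⟩ := hU.isOneLipschitzImage h2
    exact ⟨f ∘ r, by simpa using hf.comp hr, hs.comp hrs⟩
  tfae_have 4 → 3 := by
    intro h
    obtain ⟨U, _, hU⟩ := exists_isUrysohnSpace.{u}
    exact ⟨U, _, hU, h U hU⟩
  tfae_finish
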